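/- Let $\mathbb{F}_q$ be a finite field with $q$ elements, $q$ odd; all representations are complex. Fix a non-trivial character $\psi_0$ of $(\mathbb{F}_q,+)$ and $\gamma\in\mathbb{F}_q^\times$, and put $C=\mathrm{diag}(\gamma,0)$. Let $Sp_4(\mathbb{F}_q)=\{g\in GL_4(\mathbb{F}_q): {}^tgJg=J\}$, $J=\begin{bmatrix}0&I_2\\-I_2&0\end{bmatrix}$. Let $N=\left\{\begin{bmatrix}I_2&X\\0&I_2\end{bmatrix}: {}^tX=X\right\}$, with the character $\psi=\psi_C:\begin{bmatrix}I_2&X\\0&I_2\end{bmatrix}\mapsto\psi_0(\mathrm{tr}(CX))$. Let $$O_2=O_2(\mathbb{F}_q,C)=\{g\in GL_2(\mathbb{F}_q):{}^tgCg=C\}=\left\{\begin{bmatrix}\pm1&0\\y&d\end{bmatrix}: d\in\mathbb{F}_q^\times,\ y\in\mathbb{F}_q\right\},$$ embedded in $Sp_4(\mathbb{F}_q)$ by $g\mapsto\mathrm{diag}(g,{}^tg^{-1})$, let $T_2=T_2(\mathbb{F}_q,C)=\{\mathrm{diag}(\pm1,d)\}\cong\{\pm1\}\times\mathbb{F}_q^\times$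 be its diagonal subgroup, and let $O_2\to T_2$ be the quotient map $\begin{bmatrix}a&0\\y&d\end{bmatrix}\mapsto\mathrm{diag}(a,d)$. For a representation $(\pi,V)$ of a finite group, a subgroup $\mathcal U$ and a character $\theta$ of $\mathcal U$, the twisted Jacquet module $r_{\mathcal U,\theta}(\pi)$ is the quotient of $V$ by the span of all $\pi(u)v-\theta(u)v$ ($u\in\mathcal U$, $v\in V$), with the induced action of any subgroup normalizing $\mathcal U$ and $\theta$; write $r_{\mathcal U}=r_{\mathcal U,1}$. Thus $r_{N,\psi}(\pi)$ is a representation of $O_2$ for every representation $\pi$ of $Sp_4(\mathbb{F}_q)$. In $SL_2(\mathbb{F}_q)$ let $B$ be the upper triangular Borel subgroup, $N_{1,1}$ its unipotent radical and $M_{1,1}=\{\mathrm{diag}(y,y^{-1})\}\cong\mathbb{F}_q^\times$; let $\psi_\gamma$ be the character $\begin{bmatrix}1&x\\0&1\end{bmatrix}\mapsto\psi_0(\gamma x)$ of $N_{1,1}$. Let $\Psi,\Psi'$ be representatives of the two orbits of $M_{1,1}$, acting by conjugation, on the non-trivial characters of $N_{1,1}$. A representation $\tau$ of $SL_2(\mathbb{F}_q)$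 is cuspidal if $r_{N_{1,1}}(\tau)=0$. Let $Q=LU$ be the Klingen parabolic subgroup of $Sp_4(\mathbb{F}_q)$ (the stabilizer of the line spanned by the first basis vector), $L\cong\mathbb{F}_q^\times\times SL_2(\mathbb{F}_q)$. Let $\eta$ be a character of $\mathbb{F}_q^\times$, let $\tau$ be an irreducible representation of $SL_2(\mathbb{F}_q)$ with central character $\omega_\tau$ (a character of $\{\pm1\}$), and put $\Pi=\mathrm{Ind}_Q^{Sp_4(\mathbb{F}_q)}(\eta\otimes\tau)$. Let $\varrho_0$ and $\varrho_1$ be the representations of $O_2$ obtained, via the quotient map, from the representations $\omega_\tau\otimes\eta$, $\mathrm{diag}(a,d)\mapsto\omega_\tau(a)\eta(d)$, and $\eta|_{\{\pm1\}}\otimes r_{N_{1,1}}(\tau)$, $\mathrm{diag}(a,d)\mapsto\eta(a)\,r_{N_{1,1}}(\tau)(\mathrm{diag}(d,d^{-1}))$, of $T_2$, and let $\varrho_2=\omega_\tau\otimes\eta^{-1}$, a representation of $T_2$. Put $$\mu_1=\varrho_0\oplus\varrho_1\oplus\mathrm{Ind}_{T_2}^{O_2}(\varrho_2),\qquad \mu_2=\varrho_0\oplus\mathrm{Ind}_{T_2}^{O_2}(\varrho_2).$$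 Then, as representations of $O_2$: 1. If $\tau$ is one-dimensional (and, in case $q=3$, trivial), then $r_{N,\psi}(\Pi)\cong\varrho_1$. (For $q>3$ the trivial representation is the only one-dimensional representation.) 2. If $\tau$ is an irreducible principal series representation $\mathrm{Ind}_B^{SL_2(\mathbb{F}_q)}(\chi)$, or the special representation (the non-trivial component of $\mathrm{Ind}_B^{SL_2(\mathbb{F}_q)}(1)$), then $r_{N,\psi}(\Pi)\cong\mu_1$. 3. If $\tau$ is cuspidal of dimension $q-1$, then $r_{N,\psi}(\Pi)\cong\mu_2$. 4. Let $\tau=\tau_1$ be the irreducible component of $\mathrm{Ind}_B^{SL_2(\mathbb{F}_q)}(\chi)$, $\chi$ the character of order $2$ of $\mathbb{F}_q^\times$, with $r_{N_{1,1},\Psi}(\tau_1)\ne0$ and $r_{N_{1,1},\Psi'}(\tau_1)=0$. If $\psi_\gamma$ is in the $M_{1,1}$-orbit of $\Psi$, then $r_{N,\psi}(\Pi)\cong\mu_1$; otherwise $r_{N,\psi}(\Pi)\cong\varrho_1$. 5. Let $\tau=\tau_1'$ be the cuspidal irreducible representation of dimension $\frac{q-1}{2}$ with $r_{N_{1,1},\Psi}(\tau_1')\ne0$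 and $r_{N_{1,1},\Psi'}(\tau_1')=0$. If $\psi_\gamma$ is in the $M_{1,1}$-orbit of $\Psi$, then $r_{N,\psi}(\Pi)\cong\mu_2$; otherwise $r_{N,\psi}(\Pi)=0$. -/

import Mathlib

open Matrix

noncomputable section

namespace KlingenJacquet

/-! ### Generalities on complex representations -/

section General

variable {G H : Type*} [Group G] [Group H] {V : Type*} [AddCommGroup V] [Module ℂ V]

/-- The representation `g ↦ χ(g) · ρ(g)`. -/
def charTwist (χ : G →* ℂˣ) (ρ : Representation ℂ G V) : Representation ℂ G V where
  toFun g := (χ g : ℂ) • ρ g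
  map_one' := by simp
  map_mul' g h := by
    ext v
    simp [mul_smul, smul_comm (χ g : ℂ) (χ h : ℂ)]

/-- A character viewed as a one-dimensional representation on `ℂ`. -/
def charRep (χ : G →* ℂˣ) : Representation ℂ G ℂ :=
  charTwist χ (Representation.trivial ℂ G ℂ)

/-- The representation induced from a subgroup: right translation on the functions `f : G → W`
with `f (h * g) = σ h (f g)` for `h` in the subgroup (`G` is a finite group throughout). -/
abbrev induced (S : Subgroup G) (σ : Representation ℂ S V) :
    Representation ℂ G (Representation.coindV S.subtype σ) :=
  Representation.coind S.subtype σ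

/-- `σ` is an irreducible constituent of `π`, for `σ` irreducible and `G` finite. -/
def IsConstituent {W : Type*} [AddCommGroup W] [Module ℂ W]
    (σ : Representation ℂ G V) (π : Representation ℂ G W) : Prop :=
  ∃ f : σ.IntertwiningMap π, Function.Injective f

theorem exists_centralCharacter [Finite G] (ρ : Representation ℂ G V)
    [Representation.IsIrreducible ρ] :
    ∃ ω : Subgroup.center G →* ℂˣ, ∀ (z : Subgroup.center G) (v : V),
      ρ (z : G) v = (ω z : ℂ) • v := by
  classical
  have hnt : Nontrivial V := by
    by_contra hV
    rw [not_nontrivial_iff_subsingleton] at hV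
    obtain ⟨a, b, hab⟩ := (inferInstance : Nontrivial (Subrepresentation ρ))
    apply hab
    ext x
    rw [Subsingleton.elim x 0]
    exact ⟨fun _ => b.toSubmodule.zero_mem, fun _ => a.toSubmodule.zero_mem⟩
  obtain ⟨v₀, hv₀⟩ := exists_ne (0 : V)
  have hfd : FiniteDimensional ℂ V := by
    let S : Subrepresentation ρ :=
      { toSubmodule := Submodule.span ℂ (Set.range fun g => ρ g v₀)
        apply_mem_toSubmodule := by
          intro g v hv
          induction hv using Submodule.span_induction with
          | mem x hx =>
            obtain ⟨h, rfl⟩ := hx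
            exact Submodule.subset_span ⟨g * h, by simp⟩
          | zero => simp
          | add x y _ _ hx hy => rw [map_add]; exact Submodule.add_mem _ hx hy
          | smul c x _ hx => rw [map_smul]; exact Submodule.smul_mem _ _ hx }
    have hmem : v₀ ∈ S.toSubmodule := Submodule.subset_span ⟨1, by simp⟩
    have hS : S = ⊤ := by
      rcases eq_bot_or_eq_top S with h | h
      · rw [h] at hmem
        exact absurd hmem hv₀
      · exact h
    have : (⊤ : Submodule ℂ V) = Submodule.span ℂ (Set.range fun g => ρ g v₀) := by
      have := congrArg Subrepresentation.toSubmodule hS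
      exact this.symm
    exact ⟨this ▸ Submodule.fg_span (Set.finite_range _)⟩
  have hs : ∀ z : Subgroup.center G, ∃ c : ℂ, ∀ v, ρ (z : G) v = c • v := by
    intro z
    obtain ⟨c, hc⟩ :=
      (Representation.IsIrreducible.algebraMap_intertwiningMap_bijective_of_isAlgClosed
        (ρ := ρ)).2
        (Representation.IntertwiningMap.centralMul ρ (z : G) z.2)
    refine ⟨c, fun v => ?_⟩
    have := congrArg (fun f : ρ.IntertwiningMap ρ => f v) hc
    exact this.symm
  choose c hc using hs
  have hinj : ∀ a b : ℂ, a • v₀ = b • v₀ → a = b := fun a b h => smul_left_injective ℂ hv₀ h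
  let χ : Subgroup.center G →* ℂ :=
    { toFun := c
      map_one' := hinj _ _ (by rw [← hc]; simp)
      map_mul' := fun x y => hinj _ _ (by
        rw [← hc, mul_smul, ← hc y, ← hc x]; simp) }
  exact ⟨χ.toHomUnits, fun z v => hc z v⟩

open Classical in
/-- The central character of `ρ`; the default value `1` is never used when `ρ` is an irreducible
representation of a finite group. -/
def centralCharacter (ρ : Representation ℂ G V) : Subgroup.center G →* ℂˣ :=
  if h : ∃ ω : Subgroup.center G →* ℂˣ, ∀ (z : Subgroup.center G) (v : V),
      ρ (z : G) v = (ω z : ℂ) • v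
  then h.choose else 1

theorem centralCharacter_spec [Finite G] (ρ : Representation ℂ G V)
    [Representation.IsIrreducible ρ] (z : Subgroup.center G) (v : V) :
    ρ (z : G) v = (centralCharacter ρ z : ℂ) • v := by
  have h := exists_centralCharacter ρ
  rw [centralCharacter, dif_pos h]
  exact h.choose_spec z v

/-- The subgroup of `G` normalizing the subgroup `U` and stabilizing the character `θ` of `U`. -/
def charStabilizer (U : Subgroup G) (θ : U →* ℂ) : Subgroup G where
  carrier := {g | (∀ u : G, u ∈ U ↔ g * u * g⁻¹ ∈ U) ∧
    ∀ u u' : U, (u' : G) = g * u * g⁻¹ → θ u' = θ u}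
  one_mem' := by
    refine ⟨by simp, fun u u' h => ?_⟩
    have : u' = u := Subtype.ext (by simpa using h)
    rw [this]
  mul_mem' := by
    rintro a b ⟨ha, ha'⟩ ⟨hb, hb'⟩
    refine ⟨fun u => ?_, fun u u' h => ?_⟩
    · rw [hb u, ha]
      simp [mul_assoc]
    · have h1 := ha' ⟨b * u * b⁻¹, (hb u).1 u.2⟩ u' (by rw [h]; simp [mul_assoc])
      rw [h1]
      exact hb' u _ rfl
  inv_mem' := by
    rintro a ⟨ha, ha'⟩
    refine ⟨fun u => ?_, fun u u' h => ?_⟩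
    · rw [ha (a⁻¹ * u * a⁻¹⁻¹)]
      simp [mul_assoc]
    · exact (ha' u' u (by rw [h]; simp [mul_assoc])).symm

/-- The span `V(U, θ)` of the vectors `ρ(u) v - θ(u) v`. -/
def twistedKer (ρ : Representation ℂ G V) (U : Subgroup G) (θ : U →* ℂ) : Submodule ℂ V :=
  Submodule.span ℂ {x | ∃ (u : U) (v : V), x = ρ (u : G) v - θ u • v}

/-- The space `V / V(U, θ)` of the twisted Jacquet module. -/
abbrev JacquetSpace (ρ : Representation ℂ G V) (U : Subgroup G) (θ : U →* ℂ) : Type _ :=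
  V ⧸ twistedKer ρ U θ

theorem twistedKer_le_comap (ρ : Representation ℂ G V) (U : Subgroup G) (θ : U →* ℂ)
    (m : charStabilizer U θ) :
    twistedKer ρ U θ ≤ (twistedKer ρ U θ).comap ((ρ.comp (charStabilizer U θ).subtype) m) := by
  refine Submodule.span_le.2 ?_
  rintro _ ⟨u, v, rfl⟩
  obtain ⟨m, hm, hm'⟩ := m
  have h1 : θ ⟨m * u * m⁻¹, (hm u).1 u.2⟩ = θ u := hm' u _ rfl
  refine Submodule.subset_span ⟨⟨m * u * m⁻¹, (hm u).1 u.2⟩, ρ m v, ?_⟩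
  rw [h1]
  simp [← Module.End.mul_apply, ← map_mul]

/-- The twisted Jacquet module `r_{U,θ}(ρ)` as a representation of the group of all elements
normalizing `U` and `θ`. (Modular characters of finite groups are trivial.) -/
def jacquet (ρ : Representation ℂ G V) (U : Subgroup G) (θ : U →* ℂ) :
    Representation ℂ (charStabilizer U θ) (JacquetSpace ρ U θ) :=
  Representation.quotient (ρ.comp (charStabilizer U θ).subtype) (twistedKer ρ U θ)
    (twistedKer_le_comap ρ U θ)

end General

variable {F : Type*} [Field F]

/-! ### Subgroups and representations of `SL₂(F)` -/

section SL2

/-- `SL₂(F)`. -/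
abbrev SL2 (F : Type*) [Field F] : Type _ := Matrix.SpecialLinearGroup (Fin 2) F

/-- `y ↦ diag(y, y⁻¹)`. -/
def torus : Fˣ →* SL2 F where
  toFun y := ⟨!![(y : F), 0; 0, ((y⁻¹ : Fˣ) : F)], by simp [Matrix.det_fin_two]⟩
  map_one' := by
    ext i j; fin_cases i <;> fin_cases j <;> simp
  map_mul' x y := by
    apply Subtype.ext
    change !![((x * y : Fˣ) : F), 0; 0, (((x * y)⁻¹ : Fˣ) : F)] =
      !![(x : F), 0; 0, ((x⁻¹ : Fˣ) : F)] * !![(y : F), 0; 0, ((y⁻¹ : Fˣ) : F)]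
    ext i j; fin_cases i <;> fin_cases j <;> simp [Matrix.mul_apply, Fin.sum_univ_two, mul_comm]

theorem coe_torus (y : Fˣ) : ((torus y : SL2 F) : Matrix (Fin 2) (Fin 2) F) =
    !![(y : F), 0; 0, ((y⁻¹ : Fˣ) : F)] := rfl

/-- `N_{1,1}`: the upper triangular unipotent subgroup. -/
def N11 (F : Type*) [Field F] : Subgroup (SL2 F) where
  carrier := {g | ∃ x : F, (g : Matrix (Fin 2) (Fin 2) F) = !![1, x; 0, 1]}
  one_mem' := ⟨0, by ext i j; fin_cases i <;> fin_cases j <;> simp⟩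
  mul_mem' := by
    rintro a b ⟨x, hx⟩ ⟨y, hy⟩
    refine ⟨x + y, ?_⟩
    rw [Matrix.SpecialLinearGroup.coe_mul, hx, hy]
    ext i j; fin_cases i <;> fin_cases j <;> simp [Matrix.mul_apply, Fin.sum_univ_two, add_comm]
  inv_mem' := by
    rintro a ⟨x, hx⟩
    refine ⟨-x, ?_⟩
    rw [Matrix.SpecialLinearGroup.coe_inv, hx, Matrix.adjugate_fin_two]
    ext i j; fin_cases i <;> fin_cases j <;> simp

theorem N11_apply (n : N11 F) :
    ((n : SL2 F) : Matrix (Fin 2) (Fin 2) F) =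
      !![1, ((n : SL2 F) : Matrix (Fin 2) (Fin 2) F) 0 1; 0, 1] := by
  obtain ⟨n, x, hx⟩ := n
  simp [hx]

/-- The character `ψ_c` of `N_{1,1}`: the unipotent matrix with entry `x` goes to `ψ₀(c x)`. -/
def psiN11 (ψ₀ : AddChar F ℂ) (c : F) : N11 F →* ℂ where
  toFun n := ψ₀ (c * ((n : SL2 F) : Matrix (Fin 2) (Fin 2) F) 0 1)
  map_one' := by simp
  map_mul' m n := by
    rw [← AddChar.map_add_eq_mul, ← mul_add]
    congr 2
    rw [Subgroup.coe_mul, Matrix.SpecialLinearGroup.coe_mul, N11_apply m, N11_apply n]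
    simp [Matrix.mul_apply, Fin.sum_univ_two, add_comm]

theorem torus_conj_mem (y : Fˣ) (n : SL2 F) (hn : n ∈ N11 F) :
    torus y * n * (torus y)⁻¹ ∈ N11 F := by
  obtain ⟨x, hx⟩ := hn
  refine ⟨y * x * y, ?_⟩
  rw [← map_inv]
  simp only [Matrix.SpecialLinearGroup.coe_mul, hx, coe_torus]
  ext i j; fin_cases i <;> fin_cases j <;> simp [Matrix.mul_apply, Fin.sum_univ_two]

theorem torus_mem_charStabilizer (y : Fˣ) :
    torus y ∈ charStabilizer (N11 F) (1 : N11 F →* ℂ) := by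
  refine ⟨fun u => ⟨torus_conj_mem y u, fun h => ?_⟩, fun _ _ _ => rfl⟩
  have := torus_conj_mem y⁻¹ _ h
  simpa [mul_assoc] using this

/-- The Jacquet module `r_{N_{1,1}}(τ)` as a representation of
`F^× ≅ M_{1,1} = {diag(y, y⁻¹)}`. -/
def jacquetN11 {V : Type*} [AddCommGroup V] [Module ℂ V] (τ : Representation ℂ (SL2 F) V) :
    Representation ℂ Fˣ (JacquetSpace τ (N11 F) 1) :=
  (jacquet τ (N11 F) 1).comp (torus.codRestrict _ torus_mem_charStabilizer)

/-- `τ` is cuspidal if its Jacquet module `r_{N_{1,1}}(τ)` is zero. -/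
def IsCuspidal {V : Type*} [AddCommGroup V] [Module ℂ V] (τ : Representation ℂ (SL2 F) V) : Prop :=
  Subsingleton (JacquetSpace τ (N11 F) 1)

/-- `Ψ'` lies in the orbit of `Ψ` under the conjugation action
`(m · Ψ)(n) = Ψ(m⁻¹ n m)` of `M_{1,1}` on the characters of `N_{1,1}`. -/
def InTorusOrbit (Ψ Ψ' : N11 F →* ℂ) : Prop :=
  ∃ y : Fˣ, ∀ n n' : N11 F, (n' : SL2 F) = (torus y)⁻¹ * n * torus y → Ψ' n = Ψ n'

/-- The Borel subgroup of upper triangular matrices. -/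
def borel (F : Type*) [Field F] : Subgroup (SL2 F) where
  carrier := {g | (g : Matrix (Fin 2) (Fin 2) F) 1 0 = 0}
  one_mem' := by simp
  mul_mem' := by
    intro a b ha hb
    simp only [Set.mem_ofPred_eq] at ha hb ⊢
    simp [Matrix.mul_apply, Fin.sum_univ_two, ha, hb]
  inv_mem' := by
    intro a ha
    simp only [Set.mem_ofPred_eq] at ha ⊢
    simp [Matrix.SpecialLinearGroup.coe_inv, Matrix.adjugate_fin_two, ha]

/-- The quotient map from the Borel subgroup to `M_{1,1} ≅ F^×`: the upper left entry. -/
def borelToTorus : borel F →* Fˣ where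
  toFun b := Units.mk0 (((b : SL2 F) : Matrix (Fin 2) (Fin 2) F) 0 0) (by
    intro h
    have h1 := (b : SL2 F).det_coe
    have h2 : ((b : SL2 F) : Matrix (Fin 2) (Fin 2) F) 1 0 = 0 := b.2
    rw [Matrix.det_fin_two, h, h2] at h1
    simp at h1)
  map_one' := by ext; simp
  map_mul' a b := by
    have h2 : ((b : SL2 F) : Matrix (Fin 2) (Fin 2) F) 1 0 = 0 := b.2
    ext; simp [Matrix.mul_apply, Fin.sum_univ_two, h2]

/-- The principal series representation `Ind_B^{SL₂(F)}(χ)`. -/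
abbrev principalSeries (χ : Fˣ →* ℂˣ) :
    Representation ℂ (SL2 F)
      (Representation.coindV (borel F).subtype (charRep (χ.comp borelToTorus))) :=
  induced (borel F) (charRep (χ.comp borelToTorus))

/-- `τ` is (isomorphic to) a principal series representation. -/
def IsPrincipalSeries {V : Type*} [AddCommGroup V] [Module ℂ V]
    (τ : Representation ℂ (SL2 F) V) : Prop :=
  ∃ χ : Fˣ →* ℂˣ, Nonempty (τ.Equiv (principalSeries χ))

/-- The irreducible representation `τ` is the special representation: the non-trivial component of
`Ind_B^{SL₂(F)}(1)`. -/
def IsSteinberg {V : Type*} [AddCommGroup V] [Module ℂ V]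
    (τ : Representation ℂ (SL2 F) V) : Prop :=
  ¬ τ.IsTrivial ∧ IsConstituent τ (principalSeries (1 : Fˣ →* ℂˣ))

end SL2

/-! ### Parabolic subgroups of `Sp₄(F)` -/

section Sp4

/-- `Sp₄(F)`, with basis `e₁, e₂, e₁^∨, e₂^∨` indexed by `inl 0, inl 1, inr 0, inr 1`. -/
abbrev Sp4 (F : Type*) [Field F] : Type _ := Matrix.symplecticGroup (Fin 2) F

/-- The basis vector `e₁`. -/
def e1 (F : Type*) [Field F] : Fin 2 ⊕ Fin 2 → F := Pi.single (Sum.inl 0) 1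

/-- The Klingen parabolic subgroup `Q`: the stabilizer of the line spanned by `e₁`. -/
def klingen (F : Type*) [Field F] : Subgroup (Sp4 F) where
  carrier := {g | ∃ t : Fˣ, (g : Matrix (Fin 2 ⊕ Fin 2) (Fin 2 ⊕ Fin 2) F) *ᵥ e1 F = (t : F) • e1 F}
  one_mem' := ⟨1, by simp⟩
  mul_mem' := by
    rintro a b ⟨s, hs⟩ ⟨t, ht⟩
    refine ⟨s * t, ?_⟩
    rw [Submonoid.coe_mul, ← Matrix.mulVec_mulVec, ht, Matrix.mulVec_smul, hs, smul_smul]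
    simp [mul_comm]
  inv_mem' := by
    rintro a ⟨t, ht⟩
    refine ⟨t⁻¹, ?_⟩
    have h1 : ((a⁻¹ : Sp4 F) : Matrix (Fin 2 ⊕ Fin 2) (Fin 2 ⊕ Fin 2) F) *
        (a : Matrix (Fin 2 ⊕ Fin 2) (Fin 2 ⊕ Fin 2) F) = 1 := by
      rw [← Submonoid.coe_mul, inv_mul_cancel, Submonoid.coe_one]
    have h2 := congrArg
      (fun v => ((a⁻¹ : Sp4 F) : Matrix (Fin 2 ⊕ Fin 2) (Fin 2 ⊕ Fin 2) F) *ᵥ v) ht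
    simp only [Matrix.mulVec_mulVec, h1, Matrix.one_mulVec, Matrix.mulVec_smul] at h2
    nth_rewrite 2 [h2]
    rw [smul_smul]
    simp

theorem klingen_col (q : klingen F) (i : Fin 2 ⊕ Fin 2) (hi : i ≠ Sum.inl 0) :
    ((q : Sp4 F) : Matrix (Fin 2 ⊕ Fin 2) (Fin 2 ⊕ Fin 2) F) i (Sum.inl 0) = 0 := by
  obtain ⟨q, t, ht⟩ := q
  have := congrFun ht i
  simpa [e1, Matrix.mulVec_single, hi] using this

theorem klingen_ne_zero (q : klingen F) :
    ((q : Sp4 F) : Matrix (Fin 2 ⊕ Fin 2) (Fin 2 ⊕ Fin 2) F) (Sum.inl 0) (Sum.inl 0) ≠ 0 := by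
  obtain ⟨q, t, ht⟩ := q
  have := congrFun ht (Sum.inl 0)
  simp [e1, Matrix.mulVec_single] at this
  simp [this]

theorem symplectic_entry (g : Sp4 F) (i j : Fin 2 ⊕ Fin 2) :
    let A : Matrix (Fin 2 ⊕ Fin 2) (Fin 2 ⊕ Fin 2) F := g
    A (Sum.inr 0) i * A (Sum.inl 0) j + A (Sum.inr 1) i * A (Sum.inl 1) j
      - A (Sum.inl 0) i * A (Sum.inr 0) j - A (Sum.inl 1) i * A (Sum.inr 1) j
      = Matrix.J (Fin 2) F i j := by
  intro A
  have h := congrFun (congrFun (SymplecticGroup.mem_iff'.1 g.2) i) j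
  rw [← h]
  simp [Matrix.mul_apply, Matrix.J, Fintype.sum_sum_type, Fin.sum_univ_two, A, Matrix.one_apply]
  ring

theorem klingen_row (q : klingen F) (j : Fin 2 ⊕ Fin 2) (hj : j ≠ Sum.inr 0) :
    ((q : Sp4 F) : Matrix (Fin 2 ⊕ Fin 2) (Fin 2 ⊕ Fin 2) F) (Sum.inr 0) j = 0 := by
  have h := symplectic_entry (q : Sp4 F) (Sum.inl 0) j
  simp only [klingen_col q (Sum.inr 0) (by simp), klingen_col q (Sum.inr 1) (by simp),
    klingen_col q (Sum.inl 1) (by simp)] at h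
  have hJ : Matrix.J (Fin 2) F (Sum.inl 0) j = 0 := by
    rcases j with j | j
    · simp [Matrix.J]
    · have : (0 : Fin 2) ≠ j := fun h => hj (by rw [h])
      simp [Matrix.J, this]
  rw [hJ] at h
  simpa [klingen_ne_zero q] using h

/-- The first component `Q → F^×`, `q ↦ t`, of the quotient map from `Q` to its Levi subgroup
`L ≅ F^× × SL₂(F)`. -/
def klingenGL1 : klingen F →* Fˣ where
  toFun q := Units.mk0 _ (klingen_ne_zero q)
  map_one' := by ext; simp
  map_mul' a b := by
    ext
    simp [Matrix.mul_apply, Fintype.sum_sum_type, Fin.sum_univ_two,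
      klingen_col b (Sum.inl 1) (by simp), klingen_col b (Sum.inr 0) (by simp),
      klingen_col b (Sum.inr 1) (by simp)]

/-- The block of a matrix in the rows and columns of `e₂, e₂^∨`. -/
def middleBlock (A : Matrix (Fin 2 ⊕ Fin 2) (Fin 2 ⊕ Fin 2) F) : Matrix (Fin 2) (Fin 2) F :=
  !![A (Sum.inl 1) (Sum.inl 1), A (Sum.inl 1) (Sum.inr 1);
    A (Sum.inr 1) (Sum.inl 1), A (Sum.inr 1) (Sum.inr 1)]

/-- The second component `Q → SL₂(F)` of the quotient map from `Q` to its Levi subgroup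
`L ≅ F^× × SL₂(F)`: the block of `q` in the rows and columns of `e₂, e₂^∨`. -/
def klingenSL2 : klingen F →* SL2 F where
  toFun q := ⟨middleBlock ((q : Sp4 F) : Matrix (Fin 2 ⊕ Fin 2) (Fin 2 ⊕ Fin 2) F), by
    have h := symplectic_entry (q : Sp4 F) (Sum.inl 1) (Sum.inr 1)
    simp only [klingen_row q (Sum.inl 1) (by simp), klingen_row q (Sum.inr 1) (by simp)] at h
    simp [Matrix.J] at h
    simp [middleBlock, Matrix.det_fin_two]
    linear_combination -h⟩
  map_one' := by
    ext i j; fin_cases i <;> fin_cases j <;> simp [middleBlock]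
  map_mul' a b := by
    apply Subtype.ext
    change middleBlock (((a * b : klingen F) : Sp4 F) : Matrix (Fin 2 ⊕ Fin 2) (Fin 2 ⊕ Fin 2) F) =
      middleBlock ((a : Sp4 F) : Matrix _ _ F) * middleBlock ((b : Sp4 F) : Matrix _ _ F)
    ext i j
    fin_cases i <;> fin_cases j <;>
    simp [middleBlock, Matrix.mul_apply, Fintype.sum_sum_type, Fin.sum_univ_two,
      klingen_col a (Sum.inl 1) (by simp), klingen_col a (Sum.inr 1) (by simp),
      klingen_row b (Sum.inl 1) (by simp), klingen_row b (Sum.inr 1) (by simp)]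

/-- The representation `η ⊗ τ` of `L ≅ F^× × SL₂(F)`, extended to `Q` trivially on the unipotent
radical. -/
def klingenInflation {V : Type*} [AddCommGroup V] [Module ℂ V] (η : Fˣ →* ℂˣ)
    (τ : Representation ℂ (SL2 F) V) : Representation ℂ (klingen F) V :=
  charTwist (η.comp klingenGL1) (τ.comp klingenSL2)

/-- The representation `Π = Ind_Q^{Sp₄(F)}(η ⊗ τ)`. -/
abbrev klingenInd {V : Type*} [AddCommGroup V] [Module ℂ V] (η : Fˣ →* ℂˣ)
    (τ : Representation ℂ (SL2 F) V) :
    Representation ℂ (Sp4 F) (Representation.coindV (klingen F).subtype (klingenInflation η τ)) :=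
  induced (klingen F) (klingenInflation η τ)

/-- The unipotent radical `N` of the Siegel parabolic subgroup. -/
def siegelN (F : Type*) [Field F] : Subgroup (Sp4 F) where
  carrier := {g | ∃ X : Matrix (Fin 2) (Fin 2) F, X.IsSymm ∧
    (g : Matrix (Fin 2 ⊕ Fin 2) (Fin 2 ⊕ Fin 2) F) = Matrix.fromBlocks 1 X 0 1}
  one_mem' := ⟨0, Matrix.isSymm_zero, by simp⟩
  mul_mem' := by
    rintro a b ⟨X, hX, ha⟩ ⟨Y, hY, hb⟩
    refine ⟨X + Y, hX.add hY, ?_⟩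
    rw [Submonoid.coe_mul, ha, hb, Matrix.fromBlocks_multiply]
    simp [add_comm]
  inv_mem' := by
    rintro a ⟨X, hX, ha⟩
    refine ⟨-X, hX.neg, ?_⟩
    rw [SymplecticGroup.coe_inv, ha]
    simp [Matrix.J, Matrix.fromBlocks_transpose, Matrix.fromBlocks_multiply,
      Matrix.fromBlocks_neg, hX.eq]

theorem siegelN_apply (n : siegelN F) :
    ((n : Sp4 F) : Matrix (Fin 2 ⊕ Fin 2) (Fin 2 ⊕ Fin 2) F) = Matrix.fromBlocks 1
      ((n : Sp4 F) : Matrix (Fin 2 ⊕ Fin 2) (Fin 2 ⊕ Fin 2) F).toBlocks₁₂ 0 1 := by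
  obtain ⟨n, X, hX, hn⟩ := n
  simp [hn]

/-- The matrix `C = diag(γ, 0)`. -/
def matC (γ : Fˣ) : Matrix (Fin 2) (Fin 2) F := !![(γ : F), 0; 0, 0]

/-- The character `ψ_C` of `N`: the unipotent matrix with upper right block `X` goes to
`ψ₀(tr(C X))`. -/
def psiC (ψ₀ : AddChar F ℂ) (γ : Fˣ) : siegelN F →* ℂ where
  toFun n := ψ₀ (matC γ *
    ((n : Sp4 F) : Matrix (Fin 2 ⊕ Fin 2) (Fin 2 ⊕ Fin 2) F).toBlocks₁₂).trace
  map_one' := by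
    have : (1 : Matrix (Fin 2 ⊕ Fin 2) (Fin 2 ⊕ Fin 2) F).toBlocks₁₂ = 0 := by
      rw [← Matrix.fromBlocks_one, Matrix.toBlocks_fromBlocks₁₂]
    simp [this]
  map_mul' m n := by
    rw [← AddChar.map_add_eq_mul, ← Matrix.trace_add, ← mul_add]
    congr 3
    rw [Subgroup.coe_mul, Submonoid.coe_mul, siegelN_apply m, siegelN_apply n,
      Matrix.fromBlocks_multiply]
    simp [add_comm]

/-- The embedding `g ↦ diag(g, ᵗg⁻¹)` of `GL₂(F)` onto the Siegel Levi subgroup `M`. -/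
def siegelLevi : GL (Fin 2) F →* Sp4 F where
  toFun g := ⟨Matrix.fromBlocks (g : Matrix (Fin 2) (Fin 2) F) 0 0
      ((g⁻¹ : GL (Fin 2) F) : Matrix (Fin 2) (Fin 2) F)ᵀ, by
    rw [SymplecticGroup.fromBlocks_mem_iff]
    refine ⟨by simp, by simp, ?_⟩
    rw [← Matrix.transpose_mul, ← Units.val_mul]
    simp⟩
  map_one' := by
    apply Subtype.ext
    simp
  map_mul' g h := by
    apply Subtype.ext
    simp [Matrix.fromBlocks_multiply]

end Sp4

/-! ### The group `O₂(F, C)` and its representations -/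

section O2

/-- The group `O₂(F, C)` preserving the symmetric bilinear form with matrix `C = diag(γ, 0)`. -/
def O2 (γ : Fˣ) : Subgroup (GL (Fin 2) F) where
  carrier := {g | (g : Matrix (Fin 2) (Fin 2) F)ᵀ * matC γ * (g : Matrix (Fin 2) (Fin 2) F)
    = matC γ}
  one_mem' := by simp
  mul_mem' := by
    intro a b ha hb
    simp only [Set.mem_ofPred_eq] at ha hb ⊢
    rw [Units.val_mul, Matrix.transpose_mul]
    calc _ = (b : Matrix (Fin 2) (Fin 2) F)ᵀ * ((a : Matrix (Fin 2) (Fin 2) F)ᵀ * matC γ *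
          (a : Matrix (Fin 2) (Fin 2) F)) * (b : Matrix (Fin 2) (Fin 2) F) := by
            simp only [mul_assoc]
      _ = _ := by rw [ha, hb]
  inv_mem' := by
    intro a ha
    simp only [Set.mem_ofPred_eq] at ha ⊢
    have h1 : (a : Matrix (Fin 2) (Fin 2) F) * ((a⁻¹ : GL (Fin 2) F) : Matrix (Fin 2) (Fin 2) F)
        = 1 := by rw [← Units.val_mul]; simp
    have h2 : ((a⁻¹ : GL (Fin 2) F) : Matrix (Fin 2) (Fin 2) F)ᵀ *
        (a : Matrix (Fin 2) (Fin 2) F)ᵀ = 1 := by rw [← Matrix.transpose_mul, h1]; simp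
    calc _ = ((a⁻¹ : GL (Fin 2) F) : Matrix (Fin 2) (Fin 2) F)ᵀ *
          ((a : Matrix (Fin 2) (Fin 2) F)ᵀ * matC γ * (a : Matrix (Fin 2) (Fin 2) F)) *
          ((a⁻¹ : GL (Fin 2) F) : Matrix (Fin 2) (Fin 2) F) := by rw [ha]
      _ = (((a⁻¹ : GL (Fin 2) F) : Matrix (Fin 2) (Fin 2) F)ᵀ *
          (a : Matrix (Fin 2) (Fin 2) F)ᵀ) * matC γ * ((a : Matrix (Fin 2) (Fin 2) F) *
          ((a⁻¹ : GL (Fin 2) F) : Matrix (Fin 2) (Fin 2) F)) := by simp only [mul_assoc]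
      _ = _ := by rw [h1, h2]; simp

/-- `O₂(F, C)` consists of the invertible matrices with rows `(±1, 0)` and `(y, d)`. -/
theorem mem_O2_iff (γ : Fˣ) (g : GL (Fin 2) F) :
    g ∈ O2 γ ↔ (g : Matrix (Fin 2) (Fin 2) F) 0 0 * (g : Matrix (Fin 2) (Fin 2) F) 0 0 = 1 ∧
      (g : Matrix (Fin 2) (Fin 2) F) 0 1 = 0 := by
  have hγ : (γ : F) ≠ 0 := γ.ne_zero
  have key : g ∈ O2 γ ↔
      (g : Matrix (Fin 2) (Fin 2) F)ᵀ * matC γ * (g : Matrix (Fin 2) (Fin 2) F) = matC γ := Iff.rfl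
  rw [key]
  constructor
  · intro h
    have h00 := congrFun (congrFun h 0) 0
    have h11 := congrFun (congrFun h 1) 1
    simp [matC, Matrix.mul_apply, Fin.sum_univ_two] at h00 h11
    refine ⟨?_, h11⟩
    apply mul_left_cancel₀ hγ
    linear_combination h00
  · rintro ⟨h1, h2⟩
    ext i j
    fin_cases i <;> fin_cases j <;> simp [matC, Matrix.mul_apply, Fin.sum_univ_two, h2]
    linear_combination (γ : F) * h1

/-- The diagonal entry `a = ±1` of an element of `O₂(F, C)`. -/
def o2a (γ : Fˣ) : O2 γ →* Fˣ where
  toFun g := ⟨((g : GL (Fin 2) F) : Matrix (Fin 2) (Fin 2) F) 0 0,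
    ((g : GL (Fin 2) F) : Matrix (Fin 2) (Fin 2) F) 0 0,
    ((mem_O2_iff γ g).1 g.2).1, ((mem_O2_iff γ g).1 g.2).1⟩
  map_one' := by ext; simp
  map_mul' g h := by
    ext
    simp [Matrix.mul_apply, Fin.sum_univ_two, ((mem_O2_iff γ g).1 g.2).2]

/-- The diagonal entry `d` of an element of `O₂(F, C)`. -/
def o2d (γ : Fˣ) : O2 γ →* Fˣ where
  toFun g := Units.mk0 (((g : GL (Fin 2) F) : Matrix (Fin 2) (Fin 2) F) 1 1) (by
    intro h
    have h1 := (Matrix.isUnits_det_units (g : GL (Fin 2) F)).ne_zero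
    rw [Matrix.det_fin_two, h, ((mem_O2_iff γ g).1 g.2).2] at h1
    simp at h1)
  map_one' := by ext; simp
  map_mul' g h := by
    ext
    simp [Matrix.mul_apply, Fin.sum_univ_two, ((mem_O2_iff γ h).1 h.2).2]

/-- The subgroup `T₂(F, C)` of diagonal matrices `diag(±1, d)` in `O₂(F, C)`. -/
def T2 (γ : Fˣ) : Subgroup (O2 γ) where
  carrier := {g | ((g : GL (Fin 2) F) : Matrix (Fin 2) (Fin 2) F) 1 0 = 0}
  one_mem' := by simp
  mul_mem' := by
    intro a b ha hb
    simp only [Set.mem_ofPred_eq] at ha hb ⊢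
    simp [Matrix.mul_apply, Fin.sum_univ_two, ha, hb]
  inv_mem' := by
    intro a ha
    simp only [Set.mem_ofPred_eq] at ha ⊢
    simp [Matrix.inv_def, Matrix.adjugate_fin_two, ha]

/-- The matrix `diag(a, d)` in `GL₂(F)`. -/
def diagGL (a d : Fˣ) : GL (Fin 2) F :=
  ⟨!![(a : F), 0; 0, (d : F)], !![((a⁻¹ : Fˣ) : F), 0; 0, ((d⁻¹ : Fˣ) : F)],
    by ext i j; fin_cases i <;> fin_cases j <;> simp [Matrix.mul_apply, Fin.sum_univ_two],
    by ext i j; fin_cases i <;> fin_cases j <;> simp [Matrix.mul_apply, Fin.sum_univ_two]⟩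

/-- The quotient map `O₂(F, C) → T₂(F, C)`, sending the matrix with rows `(a, 0)` and `(y, d)` to
`diag(a, d)`. -/
def o2ToT2 (γ : Fˣ) : O2 γ →* T2 γ where
  toFun g := ⟨⟨diagGL (o2a γ g) (o2d γ g), (mem_O2_iff γ _).2
    ⟨by simpa [diagGL, o2a] using ((mem_O2_iff γ g).1 g.2).1, by simp [diagGL]⟩⟩, by
      change ((diagGL _ _ : GL (Fin 2) F) : Matrix (Fin 2) (Fin 2) F) 1 0 = 0
      simp [diagGL]⟩
  map_one' := by
    apply Subtype.ext; apply Subtype.ext; apply Units.ext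
    ext i j; fin_cases i <;> fin_cases j <;> simp [diagGL]
  map_mul' g h := by
    apply Subtype.ext; apply Subtype.ext; apply Units.ext
    ext i j
    fin_cases i <;> fin_cases j <;> simp [diagGL, Matrix.mul_apply, Fin.sum_univ_two]

theorem torus_o2a_mem_center (γ : Fˣ) (t : T2 γ) :
    torus (o2a γ (t : O2 γ)) ∈ Subgroup.center (SL2 F) := by
  have h : ((o2a γ (t : O2 γ))⁻¹ : Fˣ) = o2a γ (t : O2 γ) := rfl
  rw [Subgroup.mem_center_iff]
  intro g
  apply Subtype.ext
  rw [Matrix.SpecialLinearGroup.coe_mul, Matrix.SpecialLinearGroup.coe_mul, coe_torus, h]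
  ext i j
  fin_cases i <;> fin_cases j <;>
    simp [Matrix.mul_apply, Fin.sum_univ_two, mul_comm]

/-- The map `T₂(F, C) → {±1} = Z(SL₂(F))`, `diag(a, d) ↦ a I₂`. -/
def t2ToCenter (γ : Fˣ) : T2 γ →* Subgroup.center (SL2 F) :=
  (torus.comp ((o2a γ).comp (T2 γ).subtype)).codRestrict _ (torus_o2a_mem_center γ)

/-- The character `ω ⊗ η`, `diag(a, d) ↦ ω(a I₂) η(d)`, of `T₂(F, C) ≅ {±1} × F^×`. -/
def t2Char (γ : Fˣ) (ω : Subgroup.center (SL2 F) →* ℂˣ) (η : Fˣ →* ℂˣ) : T2 γ →* ℂˣ :=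
  ω.comp (t2ToCenter γ) * η.comp ((o2d γ).comp (T2 γ).subtype)

variable {V : Type*} [AddCommGroup V] [Module ℂ V]

/-- `ϱ₀`: the inflation to `O₂(F, C)` of the representation `ω_τ ⊗ η` of `T₂(F, C)`. -/
def rho0 (γ : Fˣ) (η : Fˣ →* ℂˣ) (τ : Representation ℂ (SL2 F) V) :
    Representation ℂ (O2 γ) ℂ :=
  (charRep (t2Char γ (centralCharacter τ) η)).comp (o2ToT2 γ)

/-- The representation `η|_{±1} ⊗ r_{N_{1,1}}(τ)` of `T₂(F, C)`:
`diag(a, d) ↦ η(a) r_{N_{1,1}}(τ)(diag(d, d⁻¹))`. -/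
def rho1T (γ : Fˣ) (η : Fˣ →* ℂˣ) (τ : Representation ℂ (SL2 F) V) :
    Representation ℂ (T2 γ) (JacquetSpace τ (N11 F) 1) :=
  charTwist (η.comp ((o2a γ).comp (T2 γ).subtype))
    ((jacquetN11 τ).comp ((o2d γ).comp (T2 γ).subtype))

/-- `ϱ₁`: the inflation to `O₂(F, C)` of the representation `η|_{±1} ⊗ r_{N_{1,1}}(τ)` of
`T₂(F, C)`. -/
def rho1 (γ : Fˣ) (η : Fˣ →* ℂˣ) (τ : Representation ℂ (SL2 F) V) :
    Representation ℂ (O2 γ) (JacquetSpace τ (N11 F) 1) :=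
  (rho1T γ η τ).comp (o2ToT2 γ)

/-- `ϱ₂`: the representation `ω_τ ⊗ η⁻¹` of `T₂(F, C)`. -/
def rho2 (γ : Fˣ) (η : Fˣ →* ℂˣ) (τ : Representation ℂ (SL2 F) V) :
    Representation ℂ (T2 γ) ℂ :=
  charRep (t2Char γ (centralCharacter τ) η⁻¹)

/-- `μ₁ = ϱ₀ ⊕ ϱ₁ ⊕ Ind_{T₂}^{O₂}(ϱ₂)`. -/
abbrev mu1 (γ : Fˣ) (η : Fˣ →* ℂˣ) (τ : Representation ℂ (SL2 F) V) :=
  (rho0 γ η τ).prod ((rho1 γ η τ).prod (induced (T2 γ) (rho2 γ η τ)))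

/-- `μ₂ = ϱ₀ ⊕ Ind_{T₂}^{O₂}(ϱ₂)`. -/
abbrev mu2 (γ : Fˣ) (η : Fˣ →* ℂˣ) (τ : Representation ℂ (SL2 F) V) :=
  (rho0 γ η τ).prod (induced (T2 γ) (rho2 γ η τ))

theorem siegelLevi_conj (g : GL (Fin 2) F) (n : siegelN F) :
    ((siegelLevi g * n * (siegelLevi g)⁻¹ : Sp4 F) :
      Matrix (Fin 2 ⊕ Fin 2) (Fin 2 ⊕ Fin 2) F) =
      Matrix.fromBlocks 1 ((g : Matrix (Fin 2) (Fin 2) F) *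
        ((n : Sp4 F) : Matrix (Fin 2 ⊕ Fin 2) (Fin 2 ⊕ Fin 2) F).toBlocks₁₂ *
        (g : Matrix (Fin 2) (Fin 2) F)ᵀ) 0 1 := by
  have h1 : (g : Matrix (Fin 2) (Fin 2) F) * ((g⁻¹ : GL (Fin 2) F) : Matrix (Fin 2) (Fin 2) F)
      = 1 := by rw [← Units.val_mul]; simp
  have h2 : ((g⁻¹ : GL (Fin 2) F) : Matrix (Fin 2) (Fin 2) F)ᵀ *
      (g : Matrix (Fin 2) (Fin 2) F)ᵀ = 1 := by rw [← Matrix.transpose_mul, h1]; simp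
  rw [← map_inv, Submonoid.coe_mul, Submonoid.coe_mul, siegelN_apply n]
  change Matrix.fromBlocks _ _ _ _ * _ * Matrix.fromBlocks _ _ _ _ = _
  rw [Matrix.fromBlocks_multiply, Matrix.fromBlocks_multiply]
  simp only [inv_inv, Matrix.mul_zero, Matrix.zero_mul, add_zero, zero_add, Matrix.mul_one, h1, h2,
    Matrix.toBlocks_fromBlocks₁₂]

theorem siegelLevi_conj_mem (g : GL (Fin 2) F) (n : Sp4 F) (hn : n ∈ siegelN F) :
    siegelLevi g * n * (siegelLevi g)⁻¹ ∈ siegelN F := by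
  refine ⟨_, ?_, siegelLevi_conj g ⟨n, hn⟩⟩
  obtain ⟨X, hX, hn⟩ := hn
  simp [Matrix.IsSymm, hn, Matrix.transpose_mul, hX.eq, mul_assoc]

theorem siegelLevi_mem_charStabilizer (ψ₀ : AddChar F ℂ) (γ : Fˣ) (g : O2 γ) :
    siegelLevi (g : GL (Fin 2) F) ∈ charStabilizer (siegelN F) (psiC ψ₀ γ) := by
  refine ⟨fun u => ⟨siegelLevi_conj_mem _ u, fun h => ?_⟩, fun u u' h => ?_⟩
  · have := siegelLevi_conj_mem (g : GL (Fin 2) F)⁻¹ _ h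
    simpa [mul_assoc] using this
  · have hg : ((g : GL (Fin 2) F) : Matrix (Fin 2) (Fin 2) F)ᵀ * matC γ *
      ((g : GL (Fin 2) F) : Matrix (Fin 2) (Fin 2) F) = matC γ := g.2
    change ψ₀ _ = ψ₀ _
    congr 1
    rw [h, siegelLevi_conj, Matrix.toBlocks_fromBlocks₁₂]
    conv_rhs => rw [← hg]
    rw [← mul_assoc, Matrix.trace_mul_comm]
    simp only [mul_assoc]

/-- The embedding of `O₂(F, C)` in `Sp₄(F)` by `g ↦ diag(g, ᵗg⁻¹)`; it identifies `O₂(F, C)`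
with the stabilizer `M_ψ` of `ψ_C` in the Siegel Levi subgroup. -/
def o2Embed (ψ₀ : AddChar F ℂ) (γ : Fˣ) :
    O2 γ →* charStabilizer (siegelN F) (psiC ψ₀ γ) :=
  (siegelLevi.comp (O2 γ).subtype).codRestrict _ (siegelLevi_mem_charStabilizer ψ₀ γ)

/-- The twisted Jacquet module `r_{N,ψ_C}(π)` as a representation of `O₂(F, C)`. -/
def jacquetC (ψ₀ : AddChar F ℂ) (γ : Fˣ) (π : Representation ℂ (Sp4 F) V) :
    Representation ℂ (O2 γ) (JacquetSpace π (siegelN F) (psiC ψ₀ γ)) :=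
  (jacquet π (siegelN F) (psiC ψ₀ γ)).comp (o2Embed ψ₀ γ)

end O2

end KlingenJacquet

end

noncomputable section

namespace KlingenJacquet

/-! ### Isotypic projectors and twisted Jacquet modules -/

section TwistProj

variable {G : Type*} [Group G] {V : Type*} [AddCommGroup V] [Module ℂ V]

/-! The argument is Mackey theory for `Q \ Sp₄ / N`. A coset `Qg` is determined by the row of `g`
indexed by `inr 0`, up to scaling, so `Q \ Sp₄` is a set of lines spanned by rows `(x, y)`, and an
element of `N` with block `X` sends `(x, y)` to `(x, y + xX)`. Since `N` is finite, `r_{N,ψ}(Π)` is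
identified by a projector with the space of functions `f` in `Π` satisfying `f(gu) = ψ(u) f(g)`.

If `x = 0` and `y₀ ≠ 0`, such an `f` vanishes, because `ψ` is non-trivial on elements of `N` through
which `Q` acts trivially on the value (`coindV_siegelLevi_eq_zero`). If `x ≠ 0`, some symmetric `X`
moves `y` to `0`. This leaves three families of representatives: `w` (`x = 0`, `y₀ = 0`), `s` (`x₁ =
0`), and `s w h` with `h` in `O₂` (`x₁ ≠ 0`), the last modulo `T₂`. The stabilizers in `N` act on
the values through unipotents of `SL₂`, with character `ψ_γ` at `w` and `s w`, and the trivial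
character at `s`. With `W = r_{N₁₁,ψ_γ}(τ)`, evaluation at these points therefore gives `r_{N,ψ}(Π)
≅ W ⊗ (ω_τ ⊗ η) ⊕ ϱ₁ ⊕ Ind(W ⊗ (ω_τ ⊗ η⁻¹))`, which is `nonempty_jacquetC_equiv`. Injectivity is
`ker_decompose`, resting on `coindV_eq_zero`; surjectivity, `decompose_surjective`, uses functions
supported on single cosets.

All cases then reduce to deciding whether `W` vanishes, since `dim W ≤ 1` by uniqueness of Whittaker
models (`finrank_jacquetSpace_le_one`, a Gelfand–Kazhdan argument). For one-dimensional `τ`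
unipotents act trivially, so `W = 0`. A principal series has an explicit Whittaker vector on the big
cell. If the special representation had `W = 0`, its functions on the projective line would be
harmonic, hence constant. A cuspidal `τ` of dimension `q - 1` must meet every one of the `q - 1`
non-trivial characters, each at most once. In the two half-size cases, `ψ_γ` is conjugate to `Ψ` or
to `Ψ'`, and vanishing of the Jacquet module is constant on torus orbits. -/

theorem char_mul_char_inv {U : Type*} [Group U] (θ : U →* ℂ) (u : U) : θ u * θ u⁻¹ = 1 := by
  rw [← map_mul, mul_inv_cancel, map_one]

/-- The unnormalized projector `∑ θ(u⁻¹) ρ(u)` onto the `(U, θ)`-isotypic subspace. -/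
def twistProj (ρ : Representation ℂ G V) (U : Subgroup G) [Finite U] (θ : U →* ℂ) : V →ₗ[ℂ] V :=
  letI := Fintype.ofFinite U
  ∑ u : U, θ u⁻¹ • ρ (u : G)

variable (ρ : Representation ℂ G V) (U : Subgroup G) (θ : U →* ℂ)

theorem twistProj_apply [Fintype U] (v : V) :
    twistProj ρ U θ v = ∑ u : U, θ u⁻¹ • ρ (u : G) v := by
  simp only [twistProj, LinearMap.sum_apply, LinearMap.smul_apply]
  congr!

variable [Finite U]

theorem rep_twistProj (u : U) (v : V) : ρ (u : G) (twistProj ρ U θ v) =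
    θ u • twistProj ρ U θ v := by
  have := Fintype.ofFinite U
  rw [twistProj_apply, map_sum, Finset.smul_sum]
  refine Fintype.sum_equiv (Equiv.mulLeft u) _ _ fun x => ?_
  simp only [Equiv.coe_mulLeft, _root_.mul_inv_rev, map_mul, map_smul, smul_smul,
    Subgroup.coe_mul, Module.End.mul_apply]
  rw [mul_left_comm, char_mul_char_inv, mul_one]

theorem twistProj_rep (u : U) (v : V) : twistProj ρ U θ (ρ (u : G) v) =
    θ u • twistProj ρ U θ v := by
  have := Fintype.ofFinite U
  rw [twistProj_apply, twistProj_apply, Finset.smul_sum]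
  refine Fintype.sum_equiv (Equiv.mulRight u) _ _ fun x => ?_
  simp only [Equiv.coe_mulRight, _root_.mul_inv_rev, map_mul, smul_smul, Subgroup.coe_mul,
    Module.End.mul_apply]
  rw [← mul_assoc, char_mul_char_inv, one_mul]

theorem twistProj_of_forall {v : V} (hv : ∀ u : U, ρ (u : G) v = θ u • v) :
    twistProj ρ U θ v = (Nat.card U : ℂ) • v := by
  have := Fintype.ofFinite U
  rw [twistProj_apply]
  have : ∀ u : U, θ u⁻¹ • ρ (u : G) v = v := fun u => by
    rw [hv, smul_smul, mul_comm, char_mul_char_inv, one_smul]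
  rw [Finset.sum_congr rfl fun u _ => this u]
  simp [Nat.card_eq_fintype_card, Nat.cast_smul_eq_nsmul]

/-- This identifies the coinvariants with the image of the projector, so questions about the
quotient become questions about equivariant vectors. If the projector kills `v`, then `|U| v` is
minus a combination of the vectors `ρ(u)v - θ(u)v`. -/
theorem ker_twistProj : LinearMap.ker (twistProj ρ U θ) = twistedKer ρ U θ := by
  apply le_antisymm
  · intro v hv
    have := Fintype.ofFinite U
    have h0 : (Nat.card U : ℂ) ≠ 0 := by exact_mod_cast Nat.card_pos.ne'
    have key : (Nat.card U : ℂ) • v = - ∑ u : U, θ u⁻¹ • (ρ (u : G) v - θ u • v) := by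
      simp_rw [smul_sub, Finset.sum_sub_distrib, ← twistProj_apply, LinearMap.mem_ker.1 hv,
        smul_smul, mul_comm (θ _⁻¹), char_mul_char_inv]
      simp [Nat.card_eq_fintype_card, Nat.cast_smul_eq_nsmul]
    have : v = (Nat.card U : ℂ)⁻¹ • (Nat.card U : ℂ) • v := by
      rw [smul_smul, inv_mul_cancel₀ h0, one_smul]
    rw [this, key]
    refine Submodule.smul_mem _ _ (Submodule.neg_mem _ (Submodule.sum_mem _ fun u _ =>
      Submodule.smul_mem _ _ (Submodule.subset_span ⟨u, v, rfl⟩)))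
  · refine Submodule.span_le.2 ?_
    rintro _ ⟨u, v, rfl⟩
    simp [twistProj_rep]

theorem twistProj_rep_of_mem_charStabilizer {m : G} (hm : m ∈ charStabilizer U θ) (v : V) :
    twistProj ρ U θ (ρ m v) = ρ m (twistProj ρ U θ v) := by
  have := Fintype.ofFinite U
  obtain ⟨h1, h2⟩ := hm
  let e : U ≃ U :=
    { toFun := fun u => ⟨m * u * m⁻¹, (h1 u).1 u.2⟩
      invFun := fun u => ⟨m⁻¹ * u * m, (h1 _).2 (by simp [mul_assoc])⟩
      left_inv := fun u => Subtype.ext (by simp [mul_assoc])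
      right_inv := fun u => Subtype.ext (by simp [mul_assoc]) }
  rw [twistProj_apply, twistProj_apply, map_sum]
  symm
  refine Fintype.sum_equiv e _ _ fun u => ?_
  have h3 : θ (e u)⁻¹ = θ u⁻¹ := h2 u⁻¹ (e u)⁻¹ (by simp [e, mul_assoc])
  rw [h3, map_smul]
  simp [e, ← Module.End.mul_apply, ← map_mul]

/-- On an equivariant vector the projector is multiplication by `|U| ≠ 0`, while it annihilates
`V(U, θ)`. -/
theorem eq_zero_of_mem_twistedKer {v : V} (hv : ∀ u : U, ρ (u : G) v = θ u • v)
    (h : v ∈ twistedKer ρ U θ) : v = 0 := by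
  rw [← ker_twistProj, LinearMap.mem_ker, twistProj_of_forall ρ U θ hv] at h
  have h0 : (Nat.card U : ℂ) ≠ 0 := by exact_mod_cast Nat.card_pos.ne'
  exact (smul_eq_zero.1 h).resolve_left h0

theorem nontrivial_jacquetSpace_of_forall {v : V} (hv : ∀ u : U, ρ (u : G) v = θ u • v)
    (h : v ≠ 0) : Nontrivial (JacquetSpace ρ U θ) :=
  Submodule.Quotient.nontrivial_iff.2 fun htop =>
    h (eq_zero_of_mem_twistedKer ρ U θ hv (htop ▸ Submodule.mem_top))

end TwistProj

/-! ### Irreducible representations and a commutativity criterion for multiplicity one -/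

section Irreducible

variable {G : Type*} [Group G] {V : Type*} [AddCommGroup V] [Module ℂ V]
  (ρ : Representation ℂ G V)

theorem span_orbit_eq_top [ρ.IsIrreducible] {v : V} (hv : v ≠ 0) :
    Submodule.span ℂ (Set.range fun g => ρ g v) = ⊤ := by
  let S : Subrepresentation ρ :=
    { toSubmodule := Submodule.span ℂ (Set.range fun g => ρ g v)
      apply_mem_toSubmodule := by
        intro g x hx
        induction hx using Submodule.span_induction with
        | mem x hx =>
          obtain ⟨h, rfl⟩ := hx
          exact Submodule.subset_span ⟨g * h, by simp⟩
        | zero => simp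
        | add x y _ _ hx hy => rw [map_add]; exact Submodule.add_mem _ hx hy
        | smul c x _ hx => rw [map_smul]; exact Submodule.smul_mem _ _ hx }
  have hmem : v ∈ S.toSubmodule := Submodule.subset_span ⟨1, by simp⟩
  rcases eq_bot_or_eq_top S with h | h
  · rw [h] at hmem
    exact absurd hmem hv
  · exact congrArg Subrepresentation.toSubmodule h

theorem nontrivial_of_isIrreducible [ρ.IsIrreducible] : Nontrivial V := by
  by_contra hV
  rw [not_nontrivial_iff_subsingleton] at hV
  obtain ⟨a, b, hab⟩ := (inferInstance : Nontrivial (Subrepresentation ρ))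
  apply hab
  ext x
  rw [Subsingleton.elim x 0]
  exact ⟨fun _ => b.toSubmodule.zero_mem, fun _ => a.toSubmodule.zero_mem⟩

theorem finiteDimensional_of_isIrreducible [Finite G] [ρ.IsIrreducible] :
    FiniteDimensional ℂ V := by
  have := nontrivial_of_isIrreducible ρ
  obtain ⟨v, hv⟩ := exists_ne (0 : V)
  exact ⟨span_orbit_eq_top ρ hv ▸ Submodule.fg_span (Set.finite_range _)⟩

/-- If all the operators `e ρ(g) e` commute, then `e` has rank at most one. -/
theorem range_le_span_singleton_of_commute [Finite G] [ρ.IsIrreducible] (e : V →ₗ[ℂ] V)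
    (hcomm : ∀ g h v, e (ρ g (e (ρ h (e v)))) = e (ρ h (e (ρ g (e v))))) :
    ∃ w : V, LinearMap.range e ≤ Submodule.span ℂ {w} := by
  have hfd := finiteDimensional_of_isIrreducible ρ
  let W := LinearMap.range e
  -- Irreducibility enters here: the translates of `w` span `V`, so their images under `e` span the
  -- range of `e`.
  have hsub : ∀ S : Submodule ℂ V, ∀ w : V, w ≠ 0 → (∀ g, e (ρ g w) ∈ S) → W ≤ S := by
    rintro S w hw0 hS _ ⟨x, rfl⟩
    have hx : x ∈ Submodule.span ℂ (Set.range fun g => ρ g w) := by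
      rw [span_orbit_eq_top ρ hw0]; trivial
    induction hx using Submodule.span_induction with
    | mem x hx => obtain ⟨g, rfl⟩ := hx; exact hS g
    | zero => simp
    | add x y _ _ hx hy => rw [map_add]; exact S.add_mem hx hy
    | smul c x _ hx => rw [map_smul]; exact S.smul_mem _ hx
  by_cases hW : W = ⊥
  · exact ⟨0, by change W ≤ _; rw [hW]; exact bot_le⟩
  obtain ⟨w₀, hw₀, hw₀0⟩ := W.ne_bot_iff.1 hW
  have hnt : Nontrivial W := W.nontrivial_iff_ne_bot.2 hW
  have hscalar : ∀ g, ∃ c : ℂ, ∀ w ∈ W, e (ρ g w) = c • w := by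
    intro g
    let T : W →ₗ[ℂ] W := (e.comp (ρ g)).restrict (p := W) (q := W) fun w _ => ⟨_, rfl⟩
    obtain ⟨c, hc⟩ := Module.End.exists_eigenvalue T
    obtain ⟨w, hw⟩ := hc.exists_hasEigenvector
    have hTw : e (ρ g (w : V)) = c • (w : V) := congrArg Subtype.val hw.apply_eq_smul
    refine ⟨c, ?_⟩
    -- By commutativity this eigenspace contains `e ρ(h) w` for every `h`, hence all of `W`. So each
    -- `e ρ(g)` is scalar on `W`, and `W` is spanned by any one of its nonzero vectors.
    let S : Submodule ℂ V := LinearMap.ker (e.comp (ρ g) - c • LinearMap.id)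
    have hmem : ∀ x, x ∈ S ↔ e (ρ g x) = c • x := fun x => by
      simp [S, sub_eq_zero]
    have := hsub S w (fun h => hw.2 (Subtype.ext h)) fun h => by
      rw [hmem]
      obtain ⟨v, hv⟩ := w.2
      have h1 := hcomm g h v
      rw [hv] at h1
      rw [h1, hTw, map_smul, map_smul]
    exact fun x hx => (hmem x).1 (this hx)
  choose c hc using hscalar
  refine ⟨w₀, hsub _ w₀ hw₀0 fun g => ?_⟩
  rw [hc g w₀ hw₀]
  exact Submodule.smul_mem _ _ (Submodule.mem_span_singleton_self _)

end Irreducible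

/-! ### Functions supported on one coset of an induced representation -/

section Delta

variable {G : Type*} [Group G] {V : Type*} [AddCommGroup V] [Module ℂ V]
  (S : Subgroup G) (σ : Representation ℂ S V)

open Classical in
/-- The element of the induced representation supported on the coset `S g₀`
with value `v` at `g₀`. -/
def inducedDelta (g₀ : G) (v : V) : Representation.coindV S.subtype σ :=
  ⟨fun g => if h : g * g₀⁻¹ ∈ S then σ ⟨g * g₀⁻¹, h⟩ v else 0, by
    rw [Representation.mem_coindV]
    intro s g
    have hiff : (S.subtype s * g) * g₀⁻¹ ∈ S ↔ g * g₀⁻¹ ∈ S := by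
      rw [mul_assoc]; exact S.mul_mem_cancel_left s.2
    by_cases h : g * g₀⁻¹ ∈ S
    · rw [dif_pos h, dif_pos (hiff.2 h), ← Module.End.mul_apply, ← map_mul]
      congr 2
      exact Subtype.ext (mul_assoc _ _ _)
    · rw [dif_neg h, dif_neg (mt hiff.1 h), map_zero]⟩

variable {S}

theorem inducedDelta_of_mem {g₀ g : G} (v : V) (h : g * g₀⁻¹ ∈ S) :
    (inducedDelta S σ g₀ v).1 g = σ ⟨g * g₀⁻¹, h⟩ v := dif_pos h

theorem inducedDelta_of_notMem {g₀ g : G} (v : V) (h : g * g₀⁻¹ ∉ S) :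
    (inducedDelta S σ g₀ v).1 g = 0 := dif_neg h

theorem induced_apply_apply (g : G) (f : Representation.coindV S.subtype σ) (x : G) :
    (induced S σ g f).1 x = f.1 (x * g) := rfl

variable {σ} in
theorem coindV_mul (f : Representation.coindV S.subtype σ) (s : S) (g : G) :
    f.1 ((s : G) * g) = σ s (f.1 g) := f.2 s g

/-- An induced representation is spanned by the translates of functions supported on the
identity coset. -/
theorem induced_eq_sum_delta [Fintype G] (f : Representation.coindV S.subtype σ) :
    (Nat.card S : ℂ) • f = ∑ g : G, induced S σ g⁻¹ (inducedDelta S σ 1 (f.1 g)) := by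
  classical
  ext x
  have h1 : (∑ g : G, induced S σ g⁻¹ (inducedDelta S σ 1 (f.1 g))).1 x =
      ∑ g : G, (inducedDelta S σ 1 (f.1 g)).1 (x * g⁻¹) := by
    rw [AddSubmonoidClass.coe_finsetSum, Finset.sum_apply]
    rfl
  have h2 : ∀ g : G, (inducedDelta S σ 1 (f.1 g)).1 (x * g⁻¹) =
      if x * g⁻¹ ∈ S then f.1 x else 0 := by
    intro g
    split_ifs with h
    · have h' : x * g⁻¹ * 1⁻¹ ∈ S := by simpa using h
      rw [inducedDelta_of_mem _ _ h', ← coindV_mul]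
      simp
    · exact inducedDelta_of_notMem _ _ (by simpa using h)
  have h3 : (Finset.univ.filter fun g : G => x * g⁻¹ ∈ S).card = Nat.card S := by
    rw [Nat.card_eq_fintype_card, ← Finset.card_univ]
    refine Finset.card_bij' (fun g hg => ⟨x * g⁻¹, by simpa using hg⟩)
      (fun s _ => (s : G)⁻¹ * x) ?_ ?_ ?_ ?_ <;> simp
  change _ = (∑ g : G, induced S σ g⁻¹ (inducedDelta S σ 1 (f.1 g))).1 x
  rw [h1, Finset.sum_congr rfl fun g _ => h2 g, ← Finset.sum_filter, Finset.sum_const, h3,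
    ← Nat.cast_smul_eq_nsmul ℂ]
  rfl

variable (U : Subgroup G) [Finite U] (θ : U →* ℂ)

theorem twistProj_induced_apply [Fintype U] (f : Representation.coindV S.subtype σ) (g : G) :
    (twistProj (induced S σ) U θ f).1 g = ∑ u : U, θ u⁻¹ • f.1 (g * u) := by
  rw [twistProj_apply, AddSubmonoidClass.coe_finsetSum, Finset.sum_apply]
  rfl

theorem twistProj_induced_mul (f : Representation.coindV S.subtype σ) (g : G) (u : U) :
    (twistProj (induced S σ) U θ f).1 (g * u) =
      θ u • (twistProj (induced S σ) U θ f).1 g := by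
  rw [← induced_apply_apply, rep_twistProj]
  rfl

/-- The hypothesis says that `g` lies outside the double coset `S g₀ U`, which contains the support
of the projected function. -/
theorem twistProj_delta_eq_zero {g₀ g : G} (v : V) (h : ∀ u ∈ U, g * u * g₀⁻¹ ∉ S) :
    (twistProj (induced S σ) U θ (inducedDelta S σ g₀ v)).1 g = 0 := by
  have := Fintype.ofFinite U
  rw [twistProj_induced_apply]
  exact Finset.sum_eq_zero fun u _ => by rw [inducedDelta_of_notMem _ _ (h u u.2), smul_zero]

/-- Only the `u` with `g₀ u g₀⁻¹ ∈ S` contribute to the value at `g₀`, and the compatibility of `μ`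
with `θ` makes all their contributions equal to `μ v`. Thus `k` counts these `u`; it is nonzero
because `u = 1` is among them. -/
theorem exists_twistProj_delta {W : Type*} [AddCommGroup W] [Module ℂ W] (μ : V →ₗ[ℂ] W) (g₀ : G)
    (hμ : ∀ (u : U) (s : S) (v : V), (s : G) = g₀ * u * g₀⁻¹ → μ (σ s v) = θ u • μ v) :
    ∃ k : ℂ, k ≠ 0 ∧ ∀ v : V,
      μ ((twistProj (induced S σ) U θ (inducedDelta S σ g₀ v)).1 g₀) = k • μ v := by
  classical
  have := Fintype.ofFinite U
  refine ⟨((Finset.univ.filter fun u : U => g₀ * u * g₀⁻¹ ∈ S).card : ℂ), ?_, fun v => ?_⟩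
  · rw [Nat.cast_ne_zero, ← Nat.pos_iff_ne_zero, Finset.card_pos]
    exact ⟨1, by simp⟩
  · rw [twistProj_induced_apply, map_sum, Nat.cast_smul_eq_nsmul, ← Finset.sum_const,
      Finset.sum_filter]
    refine Finset.sum_congr rfl fun u _ => ?_
    split_ifs with h
    · rw [inducedDelta_of_mem _ _ h, map_smul, hμ u _ v rfl, smul_smul, mul_comm,
        char_mul_char_inv, one_smul]
    · rw [inducedDelta_of_notMem _ _ h, smul_zero, map_zero]

end Delta

/-! ### Discarding zero summands -/

section Equivs

variable {G : Type*} [Group G] {V W : Type*} [AddCommGroup V] [Module ℂ V]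
  [AddCommGroup W] [Module ℂ W]

theorem nonempty_prod_equiv_right [Subsingleton V] (ρ : Representation ℂ G V)
    (σ : Representation ℂ G W) : Nonempty ((ρ.prod σ).Equiv σ) :=
  ⟨(Representation.IntertwiningMap.snd ℂ ρ σ).ofBijective
    ⟨fun _ _ h => Prod.ext (Subsingleton.elim _ _) h, Prod.snd_surjective⟩⟩

theorem nonempty_prod_equiv_left [Subsingleton W] (ρ : Representation ℂ G V)
    (σ : Representation ℂ G W) : Nonempty ((ρ.prod σ).Equiv ρ) :=
  ⟨(Representation.IntertwiningMap.fst ℂ ρ σ).ofBijective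
    ⟨fun _ _ h => Prod.ext h (Subsingleton.elim _ _), Prod.fst_surjective⟩⟩

end Equivs

/-! ### Unipotents, the Bruhat decomposition and an anti-involution of `SL₂` -/

section SL2Elements

variable {F : Type*} [Field F]

instance finite_SL2 [Finite F] : Finite (SL2 F) :=
  inferInstanceAs (Finite {A : Matrix (Fin 2) (Fin 2) F // A.det = 1})

/-- The upper triangular unipotent matrix with entry `x`. -/
def unip (x : F) : SL2 F := ⟨!![1, x; 0, 1], by simp [Matrix.det_fin_two]⟩

/-- The element of `N_{1,1}` with entry `x`. -/
def unipN (x : F) : N11 F := ⟨unip x, x, rfl⟩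

theorem coe_unipN (x : F) : ((unipN x : N11 F) : SL2 F) = unip x := rfl

theorem unipN_add (x y : F) : unipN (x + y) = unipN x * unipN y := by
  apply Subtype.ext; apply Subtype.ext
  change !![1, x + y; 0, 1] = !![1, x; 0, 1] * !![1, y; 0, 1]
  ext i j; fin_cases i <;> fin_cases j <;> simp [Matrix.mul_apply, Fin.sum_univ_two, add_comm]

theorem unip_add (x y : F) : unip (x + y) = unip x * unip y :=
  congrArg Subtype.val (unipN_add x y)

theorem unipN_zero : unipN (0 : F) = 1 := by
  apply Subtype.ext; apply Subtype.ext
  change !![1, (0 : F); 0, 1] = 1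
  ext i j; fin_cases i <;> fin_cases j <;> simp

theorem unip_zero : unip (0 : F) = 1 := congrArg Subtype.val unipN_zero

theorem exists_unipN (n : N11 F) : ∃ x : F, n = unipN x := by
  obtain ⟨n, x, hx⟩ := n
  exact ⟨x, Subtype.ext (Subtype.ext hx)⟩

theorem unipN_injective : Function.Injective (unipN : F → N11 F) := by
  intro x y h
  have := congrArg (fun n : N11 F => ((n : SL2 F) : Matrix (Fin 2) (Fin 2) F) 0 1) h
  simpa [unipN, unip] using this

/-- The parametrization of `N_{1,1}` by `F`. -/
def unipEquiv : F ≃ N11 F :=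
  Equiv.ofBijective unipN ⟨unipN_injective, fun n => (exists_unipN n).imp fun _ h => h.symm⟩

theorem psiN11_unipN (ψ₀ : AddChar F ℂ) (c x : F) : psiN11 ψ₀ c (unipN x) = ψ₀ (c * x) := rfl

theorem psiN11_zero (ψ₀ : AddChar F ℂ) : psiN11 ψ₀ (0 : F) = 1 := by
  ext n
  simp [psiN11]

theorem torus_mul_unip (y : Fˣ) (x : F) : torus y * unip x = unip (y * x * y) * torus y := by
  apply Subtype.ext
  change !![(y : F), 0; 0, ((y⁻¹ : Fˣ) : F)] * !![1, x; 0, 1] =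
    !![1, y * x * y; 0, 1] * !![(y : F), 0; 0, ((y⁻¹ : Fˣ) : F)]
  ext i j; fin_cases i <;> fin_cases j <;> simp [Matrix.mul_apply, Fin.sum_univ_two]

/-- The antidiagonal element with lower left entry `c`. -/
def antidiag (c : Fˣ) : SL2 F :=
  ⟨!![0, -((c⁻¹ : Fˣ) : F); (c : F), 0], by simp [Matrix.det_fin_two]⟩

theorem eq_unip_mul_antidiag_mul_unip (g : SL2 F) (c : Fˣ)
    (hc : (g : Matrix (Fin 2) (Fin 2) F) 1 0 = c) :
    g = unip ((g : Matrix (Fin 2) (Fin 2) F) 0 0 * (c⁻¹ : Fˣ)) * antidiag c *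
      unip ((g : Matrix (Fin 2) (Fin 2) F) 1 1 * (c⁻¹ : Fˣ)) := by
  have hdet := g.det_coe
  have hc0 : (c : F) ≠ 0 := c.ne_zero
  rw [Matrix.det_fin_two, hc] at hdet
  apply Subtype.ext
  simp only [Matrix.SpecialLinearGroup.coe_mul]
  change g.1 = !![1, g.1 0 0 * ((c⁻¹ : Fˣ) : F); 0, 1] * !![0, -((c⁻¹ : Fˣ) : F); (c : F), 0] *
    !![1, g.1 1 1 * ((c⁻¹ : Fˣ) : F); 0, 1]
  ext i j
  fin_cases i <;> fin_cases j <;> simp [Matrix.mul_apply, Fin.sum_univ_two, hc]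
  · field_simp
    linear_combination -hdet
  · field_simp

/-- The anti-involution of `SL₂` exchanging the diagonal entries. -/
def antiFlip (g : SL2 F) : SL2 F :=
  ⟨!![g.1 1 1, g.1 0 1; g.1 1 0, g.1 0 0], by
    have := g.det_coe
    rw [Matrix.det_fin_two] at this
    simp [Matrix.det_fin_two]
    linear_combination this⟩

theorem antiFlip_mul (g h : SL2 F) : antiFlip (g * h) = antiFlip h * antiFlip g := by
  apply Subtype.ext
  rw [Matrix.SpecialLinearGroup.coe_mul]
  simp only [antiFlip, Matrix.SpecialLinearGroup.coe_mul]
  ext i j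
  fin_cases i <;> fin_cases j <;> simp [Matrix.mul_apply, Fin.sum_univ_two] <;> ring

theorem antiFlip_of_mem_N11 (n : N11 F) : antiFlip (n : SL2 F) = n := by
  obtain ⟨x, rfl⟩ := exists_unipN n
  rfl

end SL2Elements

/-! ### Uniqueness of Whittaker models for `SL₂` -/

section Whittaker

variable {F : Type*} [Field F] [Finite F] {V : Type*} [AddCommGroup V] [Module ℂ V]
  (τ : Representation ℂ (SL2 F) V)

/-- The Bessel operator of `g` with respect to the character `θ` of `N_{1,1}`. -/
def bessel (θ : N11 F →* ℂ) (g : SL2 F) : V →ₗ[ℂ] V :=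
  twistProj τ (N11 F) θ ∘ₗ τ g ∘ₗ twistProj τ (N11 F) θ

theorem bessel_apply (θ : N11 F →* ℂ) (g : SL2 F) (v : V) :
    bessel τ θ g v = twistProj τ (N11 F) θ (τ g (twistProj τ (N11 F) θ v)) := rfl

theorem bessel_mul_left (θ : N11 F →* ℂ) (n : N11 F) (g : SL2 F) :
    bessel τ θ (n * g) = θ n • bessel τ θ g := by
  ext v
  simp [bessel_apply, twistProj_rep]

theorem bessel_mul_right (θ : N11 F →* ℂ) (n : N11 F) (g : SL2 F) :
    bessel τ θ (g * n) = θ n • bessel τ θ g := by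
  ext v
  simp [bessel_apply, rep_twistProj]

/-- Conjugation by `g` rescales `N₁₁` by a factor different from `1`, so equivariance on the left
and on the right gives incompatible scalars. -/
theorem bessel_eq_zero_of_upper {θ : N11 F →* ℂ} (hθ : θ ≠ 1) (g : SL2 F)
    (hc : g.1 1 0 = 0) (hne : g.1 0 0 ≠ g.1 1 1) : bessel τ θ g = 0 := by
  have hdet := g.det_coe
  rw [Matrix.det_fin_two, hc, mul_zero, sub_zero] at hdet
  obtain ⟨n, hn⟩ : ∃ n, θ n ≠ 1 := by
    by_contra! h
    exact hθ (MonoidHom.ext h)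
  obtain ⟨x, rfl⟩ := exists_unipN n
  have ha0 : g.1 0 0 ≠ 0 := fun h => by simp [h] at hdet
  have hd0 : g.1 1 1 ≠ 0 := fun h => by simp [h] at hdet
  have hne' : g.1 0 0 - g.1 1 1 ≠ 0 := sub_ne_zero.2 hne
  -- With `a`, `d` the diagonal entries, `z` solves `a z / d = z + x`, so that moving `unip z`
  -- across `g` produces an extra `unip x`, on which `θ` is not `1`.
  let z := x * g.1 1 1 / (g.1 0 0 - g.1 1 1)
  have key : g * unip z = unip (z + x) * g := by
    apply Subtype.ext
    simp only [Matrix.SpecialLinearGroup.coe_mul]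
    change g.1 * !![1, z; 0, 1] = !![1, z + x; 0, 1] * g.1
    ext i j
    fin_cases i <;> fin_cases j <;> simp [Matrix.mul_apply, Fin.sum_univ_two, hc]
    simp only [z]
    field_simp
    ring
  have h1 := bessel_mul_right τ θ (unipN z) g
  rw [coe_unipN, key, ← coe_unipN, bessel_mul_left, unipN_add, map_mul, mul_smul] at h1
  have hz : θ (unipN z) ≠ 0 := left_ne_zero_of_mul_eq_one (char_mul_char_inv θ (unipN z))
  have h2 : θ (unipN x) • bessel τ θ g = bessel τ θ g := smul_right_injective _ hz h1
  have h3 : (θ (unipN x) - 1) • bessel τ θ g = 0 := by rw [sub_smul, h2, one_smul, sub_self]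
  exact (smul_eq_zero.1 h3).resolve_left (sub_ne_zero.2 hn)

/-- Among upper triangular elements only those with equal diagonal entries contribute, and the
anti-involution fixes them. On the big cell it fixes the antidiagonal factor and exchanges the two
unipotent factors, whose `θ`-values commute. -/
theorem bessel_antiFlip {θ : N11 F →* ℂ} (hθ : θ ≠ 1) (g : SL2 F) :
    bessel τ θ (antiFlip g) = bessel τ θ g := by
  by_cases hc : g.1 1 0 = 0
  · by_cases had : g.1 0 0 = g.1 1 1
    · congr 1
      apply Subtype.ext
      ext i j
      fin_cases i <;> fin_cases j <;> simp [antiFlip, had]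
    · rw [bessel_eq_zero_of_upper τ hθ g hc had,
        bessel_eq_zero_of_upper τ hθ (antiFlip g) (by simpa [antiFlip] using hc)
          (by simpa [antiFlip] using Ne.symm had)]
  · have h1 := eq_unip_mul_antidiag_mul_unip g (Units.mk0 _ hc) rfl
    have h2 := eq_unip_mul_antidiag_mul_unip (antiFlip g) (Units.mk0 _ hc) rfl
    conv_rhs => rw [h1]
    rw [h2]
    simp only [← coe_unipN, bessel_mul_left, bessel_mul_right, smul_smul]
    rw [mul_comm]
    rfl

/-- This is the Gelfand–Kazhdan trick. A product of two Bessel operators is a `θ`-weighted sum of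
the operators of `g n h`; the anti-involution reverses this product and fixes `n`, while leaving
each Bessel operator unchanged. -/
theorem bessel_comm {θ : N11 F →* ℂ} (hθ : θ ≠ 1) (g h : SL2 F) (v : V) :
    bessel τ θ g (bessel τ θ h v) = bessel τ θ h (bessel τ θ g v) := by
  have := Fintype.ofFinite (N11 F)
  have hmul : ∀ (g h : SL2 F) (v : V), bessel τ θ g (bessel τ θ h v) = (Nat.card (N11 F) : ℂ) •
      ∑ n : N11 F, θ n⁻¹ • bessel τ θ (g * n * h) v := by
    intro g h v
    rw [bessel_apply, bessel_apply, twistProj_of_forall τ _ θ fun u => rep_twistProj τ _ θ u _,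
      map_smul, map_smul, twistProj_apply τ (N11 F) θ (τ h _), map_sum, map_sum]
    congr 1
    refine Finset.sum_congr rfl fun n _ => ?_
    rw [map_smul, map_smul, bessel_apply]
    simp
  calc bessel τ θ g (bessel τ θ h v)
      = bessel τ θ (antiFlip h) (bessel τ θ (antiFlip g) v) := by
        rw [hmul, hmul]
        congr 1
        refine Finset.sum_congr rfl fun n _ => ?_
        rw [← bessel_antiFlip τ hθ (g * n * h), antiFlip_mul, antiFlip_mul, antiFlip_of_mem_N11,
          mul_assoc]
    _ = _ := by rw [bessel_antiFlip τ hθ, bessel_antiFlip τ hθ]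

/-- Uniqueness of Whittaker models. -/
theorem finrank_jacquetSpace_le_one [τ.IsIrreducible] {θ : N11 F →* ℂ} (hθ : θ ≠ 1) :
    Module.finrank ℂ (JacquetSpace τ (N11 F) θ) ≤ 1 := by
  -- The product of two Bessel operators contains the projector twice in the middle. The projector
  -- is unnormalized, so this leaves a factor `|N₁₁|`, which is cancelled.
  obtain ⟨w, hw⟩ := range_le_span_singleton_of_commute τ (twistProj τ (N11 F) θ) fun g h v => by
    have hcomm := bessel_comm τ hθ g h v
    simp only [bessel_apply] at hcomm
    rw [twistProj_of_forall τ _ θ fun u => rep_twistProj τ _ θ u _,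
      twistProj_of_forall τ _ θ fun u => rep_twistProj τ _ θ u _] at hcomm
    simp only [map_smul] at hcomm
    exact smul_right_injective V (by exact_mod_cast Nat.card_pos.ne' : (Nat.card (N11 F) : ℂ) ≠ 0)
      hcomm
  have e := (twistProj τ (N11 F) θ).quotKerEquivRange
  rw [ker_twistProj] at e
  rw [e.finrank_eq]
  exact (Submodule.finrank_mono hw).trans ((finrank_span_le_card {w}).trans (by simp))

end Whittaker

/-! ### Torus orbits of characters of `N₁₁` -/

section Orbits

variable {F : Type*} [Field F] {V : Type*} [AddCommGroup V] [Module ℂ V]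
  (τ : Representation ℂ (SL2 F) V)

theorem InTorusOrbit.symm {Ψ θ : N11 F →* ℂ} (h : InTorusOrbit Ψ θ) : InTorusOrbit θ Ψ := by
  obtain ⟨y, hy⟩ := h
  exact ⟨y⁻¹, fun n n' hn => (hy n' n (by rw [hn]; simp [mul_assoc])).symm⟩

/-- The operator `τ(torus y)` carries `V(N₁₁, Ψ)` into `V(N₁₁, θ)` and is invertible, so if the
former is everything then so is the latter. -/
theorem subsingleton_jacquetSpace_of_inTorusOrbit {Ψ θ : N11 F →* ℂ} (h : InTorusOrbit Ψ θ)
    (hΨ : Subsingleton (JacquetSpace τ (N11 F) Ψ)) :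
    Subsingleton (JacquetSpace τ (N11 F) θ) := by
  rw [Submodule.Quotient.subsingleton_iff] at hΨ ⊢
  obtain ⟨y, hy⟩ := h
  have hle : twistedKer τ (N11 F) Ψ ≤ (twistedKer τ (N11 F) θ).comap (τ (torus y)) := by
    refine Submodule.span_le.2 ?_
    rintro _ ⟨n, v, rfl⟩
    refine Submodule.subset_span ⟨⟨_, torus_conj_mem y n n.2⟩, τ (torus y) v, ?_⟩
    rw [hy ⟨_, torus_conj_mem y n n.2⟩ n (by simp [mul_assoc])]
    simp [← Module.End.mul_apply, ← map_mul]
  rw [hΨ, top_le_iff] at hle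
  rw [eq_top_iff]
  intro v _
  have : τ (torus y)⁻¹ v ∈ (twistedKer τ (N11 F) θ).comap (τ (torus y)) := hle ▸ trivial
  simpa [← Module.End.mul_apply, ← map_mul] using this

theorem nontrivial_jacquetSpace_of_inTorusOrbit {Ψ θ : N11 F →* ℂ} (h : InTorusOrbit Ψ θ)
    (hΨ : Nontrivial (JacquetSpace τ (N11 F) Ψ)) :
    Nontrivial (JacquetSpace τ (N11 F) θ) := by
  by_contra hθ
  rw [not_nontrivial_iff_subsingleton] at hθ
  have := subsingleton_jacquetSpace_of_inTorusOrbit τ h.symm hθ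
  exact not_subsingleton _ this

theorem inTorusOrbit_psiN11 (ψ₀ : AddChar F ℂ) {a b : F} {s : Fˣ} (h : b = a * (s * s)) :
    InTorusOrbit (psiN11 ψ₀ a) (psiN11 ψ₀ b) := by
  refine ⟨s⁻¹, fun n n' hn => ?_⟩
  obtain ⟨x, rfl⟩ := exists_unipN n'
  have h1 : n = unipN (((s⁻¹ : Fˣ) : F) * x * ((s⁻¹ : Fˣ) : F)) := by
    apply Subtype.ext
    have h2 := torus_mul_unip s⁻¹ x
    rw [← coe_unipN, hn] at h2
    rw [coe_unipN]
    simpa only [mul_assoc, map_inv, inv_inv, inv_mul_cancel_left, mul_inv_cancel_left,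
      mul_left_inj, inv_mul_cancel, mul_inv_cancel, mul_one] using h2
  have hs : (s : F) ≠ 0 := s.ne_zero
  rw [h1, psiN11_unipN, psiN11_unipN, h, Units.val_inv_eq_inv_val]
  congr 1
  field_simp

/-- The shifts of a non-trivial additive character are pairwise distinct, and there are as many of
them as additive characters of `F`. -/
theorem exists_eq_psiN11 [Finite F] {ψ₀ : AddChar F ℂ} (hψ₀ : ψ₀ ≠ 1) (Ψ : N11 F →* ℂ) :
    ∃ c : F, Ψ = psiN11 ψ₀ c := by
  have := Fintype.ofFinite F
  let φ : AddChar F ℂ :=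
    { toFun := fun x => Ψ (unipN x)
      map_zero_eq_one' := by rw [unipN_zero, map_one]
      map_add_eq_mul' := fun x y => by rw [unipN_add, map_mul] }
  have hinj : Function.Injective fun c : F => AddChar.mulShift ψ₀ c :=
    AddChar.to_mulShift_inj_of_isPrimitive (AddChar.IsPrimitive.of_ne_one hψ₀)
  have hbij := (Fintype.bijective_iff_injective_and_card _).2 ⟨hinj, AddChar.card_eq.symm⟩
  obtain ⟨c, hc⟩ := hbij.2 φ
  refine ⟨c, MonoidHom.ext fun n => ?_⟩
  obtain ⟨x, rfl⟩ := exists_unipN n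
  have := DFunLike.congr_fun hc x
  rw [psiN11_unipN]
  exact this.symm

theorem psiN11_ne_one {ψ₀ : AddChar F ℂ} (hψ₀ : ψ₀ ≠ 1) {c : F} (hc : c ≠ 0) :
    psiN11 ψ₀ c ≠ 1 := by
  intro h
  apply hψ₀
  ext x
  have := DFunLike.congr_fun h (unipN (c⁻¹ * x))
  rw [psiN11_unipN, mul_inv_cancel_left₀ hc] at this
  simpa using this

/-- Parameters whose ratio is a nonzero square give conjugate characters. If `a`, `b`, `c` were in
three distinct classes, the ratios `b/a`, `c/b` and `c/a` would all have quadratic character `-1`,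
although the third is the product of the first two. -/
theorem inTorusOrbit_or_inTorusOrbit [Finite F] {ψ₀ : AddChar F ℂ} (hψ₀ : ψ₀ ≠ 1)
    {Ψ Ψ' θ : N11 F →* ℂ} (hΨ : Ψ ≠ 1) (hΨ' : Ψ' ≠ 1) (hθ : θ ≠ 1) (h : ¬ InTorusOrbit Ψ Ψ') :
    InTorusOrbit Ψ θ ∨ InTorusOrbit Ψ' θ := by
  classical
  have := Fintype.ofFinite F
  have hex : ∀ {Ξ : N11 F →* ℂ}, Ξ ≠ 1 → ∃ c : Fˣ, Ξ = psiN11 ψ₀ (c : F) := by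
    intro Ξ hΞ
    obtain ⟨c, rfl⟩ := exists_eq_psiN11 hψ₀ Ξ
    have hc : c ≠ 0 := fun h => hΞ (by rw [h, psiN11_zero])
    exact ⟨Units.mk0 c hc, rfl⟩
  obtain ⟨a, rfl⟩ := hex hΨ
  obtain ⟨b, rfl⟩ := hex hΨ'
  obtain ⟨c, rfl⟩ := hex hθ
  have key : ∀ a b : Fˣ, ¬ InTorusOrbit (psiN11 ψ₀ (a : F)) (psiN11 ψ₀ (b : F)) →
      quadraticChar F ((b * a⁻¹ : Fˣ) : F) = -1 := by
    intro a b hab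
    rw [quadraticChar_neg_one_iff_not_isSquare]
    rintro ⟨s, hs⟩
    have hs0 : s ≠ 0 := fun h0 => by simp [h0] at hs
    refine hab (inTorusOrbit_psiN11 ψ₀ (s := Units.mk0 s hs0) ?_)
    rw [Units.val_mk0, ← hs, ← Units.val_mul]
    simp
  by_contra! hno
  have h1 := key a b h
  have h2 := key a c hno.1
  have h3 := key b c hno.2
  have h4 : c * a⁻¹ = (c * b⁻¹) * (b * a⁻¹) := by simp [mul_assoc]
  rw [h4, Units.val_mul, map_mul, h1, h3] at h2
  norm_num at h2

end Orbits

/-! ### One-dimensional representations of `SL₂` -/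

section Degenerate

variable {F : Type*} [Field F] {V : Type*} [AddCommGroup V] [Module ℂ V]
  (τ : Representation ℂ (SL2 F) V)

theorem subsingleton_jacquetSpace_of_trivial_unip {θ : N11 F →* ℂ} (hθ : θ ≠ 1)
    (h : ∀ (n : N11 F) (v : V), τ (n : SL2 F) v = v) :
    Subsingleton (JacquetSpace τ (N11 F) θ) := by
  obtain ⟨n, hn⟩ : ∃ n, θ n ≠ 1 := by
    by_contra! h
    exact hθ (MonoidHom.ext h)
  rw [Submodule.Quotient.subsingleton_iff, eq_top_iff]
  intro v _
  have h1 : (1 - θ n) • v ∈ twistedKer τ (N11 F) θ :=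
    Submodule.subset_span ⟨n, v, by rw [h, sub_smul, one_smul]⟩
  exact (Submodule.smul_mem_iff _ (sub_ne_zero.2 hn.symm)).1 h1

theorem unip_trivial_of_finrank_eq_one [Fintype F] (hF : ringChar F ≠ 2)
    (hV : Module.finrank ℂ V = 1) (hcard : Fintype.card F ≠ 3) (n : N11 F) (v : V) :
    τ (n : SL2 F) v = v := by
  classical
  obtain ⟨v₀, -, hspan⟩ := finrank_eq_one_iff'.1 hV
  have hcomm : ∀ (g h : SL2 F) (v : V), τ g (τ h v) = τ h (τ g v) := by
    intro g h v
    obtain ⟨a, ha⟩ := hspan (τ g v₀)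
    obtain ⟨b, hb⟩ := hspan (τ h v₀)
    obtain ⟨c, rfl⟩ := hspan v
    simp only [map_smul, ← ha, ← hb, smul_comm a b]
  -- If every unit had square `1`, the field would be `{0, 1, -1}`, which has three elements in odd
  -- characteristic.
  obtain ⟨y, hy⟩ : ∃ y : Fˣ, (y : F) * y - 1 ≠ 0 := by
    by_contra! hall
    have huniv : (Finset.univ : Finset F) = {0, 1, -1} := by
      ext y
      simp only [Finset.mem_univ, Finset.mem_insert, Finset.mem_singleton, true_iff]
      by_cases hy : y = 0
      · exact Or.inl hy
      · have h1 := hall (Units.mk0 y hy)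
        have h2 : (y - 1) * (y + 1) = 0 := by
          rw [Units.val_mk0] at h1; linear_combination h1
        rcases mul_eq_zero.1 h2 with h | h
        · exact Or.inr (Or.inl (sub_eq_zero.1 h))
        · exact Or.inr (Or.inr (eq_neg_of_add_eq_zero_left h))
    apply hcard
    rw [← Finset.card_univ, huniv]
    have h1 : (1 : F) ≠ -1 := (Ring.neg_one_ne_one_of_char_ne_two hF).symm
    rw [Finset.card_insert_of_notMem, Finset.card_pair h1]
    simp
  obtain ⟨z, rfl⟩ := exists_unipN n
  -- This choice makes `unip z` the commutator of `torus y` and `unip x`, which acts trivially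
  -- because all operators on a line commute.
  let x := z / ((y : F) * y - 1)
  have hz : (y : F) * x * y = z + x := by
    have hx : x * ((y : F) * y - 1) = z := div_mul_cancel₀ _ hy
    linear_combination hx
  have h1 : τ (torus y) (τ (unip x) v) = τ (unip (y * x * y)) (τ (torus y) v) := by
    rw [← Module.End.mul_apply, ← Module.End.mul_apply, ← map_mul, ← map_mul, torus_mul_unip]
  rw [hcomm, hz, unip_add, map_mul, Module.End.mul_apply, hcomm (unip x), hcomm (unip z)] at h1
  have hinj : Function.Injective (τ (torus y)) := fun a b hab => by
    simpa [← Module.End.mul_apply, ← map_mul] using congrArg (τ (torus y)⁻¹) hab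
  have h2 := hinj h1
  rw [hcomm] at h2
  have hinj' : Function.Injective (τ (unip x)) := fun a b hab => by
    simpa [← Module.End.mul_apply, ← map_mul] using congrArg (τ (unip x)⁻¹) hab
  exact (hinj' h2).symm

end Degenerate

/-! ### Whittaker vectors in principal series -/

section PrincipalSeries

variable {F : Type*} [Field F]

theorem charRep_apply {G : Type*} [Group G] (χ : G →* ℂˣ) (g : G) (z : ℂ) :
    charRep χ g z = (χ g : ℂ) * z := by
  simp [charRep, charTwist]

open Classical in
/-- A Whittaker vector of the principal series, supported on the big cell. -/
def whittakerVector (ψ₀ : AddChar F ℂ) (c : F) (χ : Fˣ →* ℂˣ) :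
    Representation.coindV (borel F).subtype (charRep (χ.comp borelToTorus)) :=
  ⟨fun g => if h : g.1 1 0 = 0 then 0 else
      (χ (Units.mk0 (g.1 1 0) h)⁻¹ : ℂ) * ψ₀ (c * (g.1 1 1 / g.1 1 0)), by
    rw [Representation.mem_coindV]
    intro b g
    have hb : b.1.1 1 0 = 0 := b.2
    have hdet := b.1.det_coe
    rw [Matrix.det_fin_two, hb, mul_zero, sub_zero] at hdet
    have hb0 : b.1.1 1 1 ≠ 0 := fun h => by simp [h] at hdet
    have h0 : ∀ j, ((borel F).subtype b * g).1 1 j = b.1.1 1 1 * g.1 1 j := fun j => by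
      simp [Matrix.mul_apply, Fin.sum_univ_two, hb]
    rw [charRep_apply]
    by_cases h : g.1 1 0 = 0
    · rw [dif_pos h, dif_pos (by rw [h0, h, mul_zero]), mul_zero]
    · have h' : ((borel F).subtype b * g).1 1 0 ≠ 0 := by rw [h0]; exact mul_ne_zero hb0 h
      rw [dif_neg h, dif_neg h', ← mul_assoc, MonoidHom.comp_apply, ← Units.val_mul, ← map_mul]
      congr 3
      · rw [inv_eq_iff_eq_inv, _root_.mul_inv_rev, inv_inv]
        ext
        simp only [Units.val_mk0, Units.val_mul, h0, Units.val_inv_eq_inv_val, borelToTorus,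
          MonoidHom.coe_mk, OneHom.coe_mk]
        rw [mul_comm, eq_inv_of_mul_eq_one_right hdet]
      · rw [h0, h0, mul_div_mul_left _ _ hb0]⟩

theorem whittakerVector_of_eq_zero (ψ₀ : AddChar F ℂ) (c : F) (χ : Fˣ →* ℂˣ) {g : SL2 F}
    (h : g.1 1 0 = 0) : (whittakerVector ψ₀ c χ).1 g = 0 := dif_pos h

theorem whittakerVector_of_eq (ψ₀ : AddChar F ℂ) (c : F) (χ : Fˣ →* ℂˣ) {g : SL2 F} (u : Fˣ)
    (h : g.1 1 0 = u) :
    (whittakerVector ψ₀ c χ).1 g = (χ u⁻¹ : ℂ) * ψ₀ (c * (g.1 1 1 / u)) := by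
  have h0 : g.1 1 0 ≠ 0 := h ▸ u.ne_zero
  have hu : u = Units.mk0 _ h0 := Units.ext h.symm
  rw [hu]
  exact dif_neg h0

theorem whittakerVector_ne_zero (ψ₀ : AddChar F ℂ) (c : F) (χ : Fˣ →* ℂˣ) :
    whittakerVector ψ₀ c χ ≠ 0 := by
  intro h
  have h1 := congrArg (fun f => f.1 (antidiag 1)) h
  have h3 : (antidiag (1 : Fˣ)).1 1 1 = 0 := by simp [antidiag]
  simp only [whittakerVector_of_eq ψ₀ c χ 1 (show (antidiag (1 : Fˣ)).1 1 0 = _ from rfl), h3] at h1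
  simp at h1

/-- On the big cell the quotient of the lower right entry by the lower left one is the coordinate of
the right unipotent factor, and right multiplication by `unip x` adds `x` to it. The complement of
the big cell is stable under this multiplication. -/
theorem principalSeries_whittakerVector (ψ₀ : AddChar F ℂ) (c : F) (χ : Fˣ →* ℂˣ) (n : N11 F) :
    principalSeries χ (n : SL2 F) (whittakerVector ψ₀ c χ) =
      psiN11 ψ₀ c n • whittakerVector ψ₀ c χ := by
  obtain ⟨x, rfl⟩ := exists_unipN n
  ext g
  change (whittakerVector ψ₀ c χ).1 (g * unip x) = ψ₀ (c * x) * (whittakerVector ψ₀ c χ).1 g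
  have h0 : (g * unip x).1 1 0 = g.1 1 0 := by
    change (g.1 * !![1, x; 0, 1]) 1 0 = _
    simp [Matrix.mul_apply, Fin.sum_univ_two]
  have h1 : (g * unip x).1 1 1 = g.1 1 0 * x + g.1 1 1 := by
    change (g.1 * !![1, x; 0, 1]) 1 1 = _
    simp [Matrix.mul_apply, Fin.sum_univ_two]
  by_cases h : g.1 1 0 = 0
  · rw [whittakerVector_of_eq_zero _ _ _ h, whittakerVector_of_eq_zero _ _ _ (h0.trans h), mul_zero]
  · rw [whittakerVector_of_eq _ _ _ (Units.mk0 _ h) rfl,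
      whittakerVector_of_eq _ _ _ (Units.mk0 _ h) h0, h1]
    have h2 : c * ((g.1 1 0 * x + g.1 1 1) / g.1 1 0) = c * x + c * (g.1 1 1 / g.1 1 0) := by
      field_simp
    rw [Units.val_mk0, h2, AddChar.map_add_eq_mul]
    ring

theorem nontrivial_jacquetSpace_of_isPrincipalSeries [Finite F] {V : Type*} [AddCommGroup V]
    [Module ℂ V] {τ : Representation ℂ (SL2 F) V} (hτ : IsPrincipalSeries τ) (ψ₀ : AddChar F ℂ)
    (c : F) : Nontrivial (JacquetSpace τ (N11 F) (psiN11 ψ₀ c)) := by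
  obtain ⟨χ, ⟨e⟩⟩ := hτ
  refine nontrivial_jacquetSpace_of_forall τ (N11 F) (psiN11 ψ₀ c)
    (v := e.symm (whittakerVector ψ₀ c χ)) (fun n => ?_) fun h => ?_
  · have := Representation.IntertwiningMap.isIntertwining _ _ e.symm.toIntertwiningMap
      (n : SL2 F) (whittakerVector ψ₀ c χ)
    rw [principalSeries_whittakerVector] at this
    simp only [Representation.Equiv.coe_toIntertwiningMap, map_smul] at this
    exact this.symm
  · refine whittakerVector_ne_zero ψ₀ c χ ?_
    have := congrArg e h
    simpa using this

end PrincipalSeries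

/-! ### Harmonic functions on the projective line and the special representation -/

section Steinberg

variable {F : Type*} [Field F]

theorem unip_mem_borel (x : F) : unip x ∈ borel F := by
  change (!![1, x; 0, 1] : Matrix (Fin 2) (Fin 2) F) 1 0 = 0
  simp

theorem torus_mem_borel (y : Fˣ) : torus y ∈ borel F := by
  change (!![(y : F), 0; 0, ((y⁻¹ : Fˣ) : F)] : Matrix (Fin 2) (Fin 2) F) 1 0 = 0
  simp

/-- The left unipotent and torus factors of the Bruhat decomposition are absorbed by the Borel
subgroup, leaving an affine coordinate on the projective line. The extra factor `h` allows the rule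
to be used inside products. -/
theorem apply_eq_of_borel_invariant {f : SL2 F → ℂ} (hf : ∀ b ∈ borel F, ∀ g, f (b * g) = f g)
    (g h : SL2 F) (hg : g.1 1 0 ≠ 0) :
    f (g * h) = f (antidiag 1 * unip (g.1 1 1 / g.1 1 0) * h) := by
  have h1 := eq_unip_mul_antidiag_mul_unip g (Units.mk0 _ hg) rfl
  have h2 : antidiag (Units.mk0 _ hg) = torus (Units.mk0 _ hg)⁻¹ * antidiag 1 := by
    apply Subtype.ext
    generalize Units.mk0 (g.1 1 0) hg = c
    change !![0, -((c⁻¹ : Fˣ) : F); (c : F), 0] = !![((c⁻¹ : Fˣ) : F), 0; 0, ((c⁻¹⁻¹ : Fˣ) : F)] *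
      !![0, -(((1 : Fˣ)⁻¹ : Fˣ) : F); ((1 : Fˣ) : F), 0]
    ext i j
    fin_cases i <;> fin_cases j <;> simp [Matrix.mul_apply, Fin.sum_univ_two]
  rw [h2] at h1
  conv_lhs => rw [h1]
  rw [mul_assoc, mul_assoc, hf _ (unip_mem_borel _), mul_assoc,
    hf _ (torus_mem_borel _), ← mul_assoc, Units.val_inv_eq_inv_val, Units.val_mk0, div_eq_mul_inv]

theorem antidiag_mul_unip_mul_antidiag (x : F) :
    (antidiag 1 * unip x * antidiag 1 : SL2 F).1 = !![-1, 0; x, -1] := by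
  change !![0, -(((1 : Fˣ)⁻¹ : Fˣ) : F); ((1 : Fˣ) : F), 0] * !![1, x; 0, 1] *
    !![0, -(((1 : Fˣ)⁻¹ : Fˣ) : F); ((1 : Fˣ) : F), 0] = _
  ext i j
  fin_cases i <;> fin_cases j <;> simp [Matrix.mul_apply, Fin.sum_univ_two]

/-- A function on `B \ SL₂` harmonic for the action of the big cell is constant. -/
theorem eq_const_of_forall_sum_eq [Fintype F] {f : SL2 F → ℂ}
    (hf : ∀ b ∈ borel F, ∀ g, f (b * g) = f g)
    (h : ∀ g, (Fintype.card F : ℂ) * f g = ∑ x : F, f (antidiag 1 * unip x * g)) (g : SL2 F) :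
    f g = f 1 := by
  classical
  have key : ∀ (z : F) (g : SL2 F), f (antidiag 1 * unip z * g) = f g := by
    intro z g
    -- Seen from the point with coordinate `z`, the points other than itself are the one of `g`,
    -- reached at `x = 0`, and those with coordinate `z - 1/x`. Since `0⁻¹ = 0`, this bijection
    -- sends `0` to `z`; the conditional term in `h1` replaces that spurious value by the value at
    -- `g`.
    let e : F ≃ F := ((Equiv.neg F).trans (Equiv.inv F)).trans (Equiv.addRight z)
    have h1 : ∀ x : F, f (antidiag 1 * unip x * (antidiag 1 * unip z * g)) =
        f (antidiag 1 * unip (e x) * g) +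
          if x = 0 then f g - f (antidiag 1 * unip z * g) else 0 := by
      intro x
      have hmul : antidiag 1 * unip x * (antidiag 1 * unip z * g) =
        (antidiag 1 * unip x * antidiag 1) * (unip z * g) := by simp only [mul_assoc]
      have hm := antidiag_mul_unip_mul_antidiag x
      rw [hmul]
      split_ifs with hx
      · rw [hf _ ((congrFun (congrFun hm 1) 0).trans (by simpa using hx)),
          hf _ (unip_mem_borel _), hx]
        simp [e]
      · rw [apply_eq_of_borel_invariant hf _ _ (by rw [hm]; simpa using hx), hm, add_zero]
        have hz : (!![-1, 0; x, -1] : Matrix (Fin 2) (Fin 2) F) 1 1 /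
            (!![-1, 0; x, -1] : Matrix (Fin 2) (Fin 2) F) 1 0 + z = e x := by
          simp [e, div_eq_mul_inv]
        rw [← mul_assoc, mul_assoc (antidiag 1), ← unip_add, hz]
    have h2 := h (antidiag 1 * unip z * g)
    rw [Finset.sum_congr rfl fun x _ => h1 x, Finset.sum_add_distrib, Finset.sum_ite_eq',
      Equiv.sum_comp e fun u => f (antidiag 1 * unip u * g), ← h g, if_pos (Finset.mem_univ _)]
      at h2
    -- Comparing the mean value property at the two points gives `q f(z) = q f(g) + f(g) - f(z)`.
    have h3 : ((Fintype.card F : ℂ) + 1) * (f (antidiag 1 * unip z * g) - f g) = 0 := by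
      linear_combination h2
    have h4 : (Fintype.card F : ℂ) + 1 ≠ 0 := Nat.cast_add_one_ne_zero _
    exact sub_eq_zero.1 ((mul_eq_zero.1 h3).resolve_left h4)
  by_cases hc : g.1 1 0 = 0
  · have := hf g hc 1
    rwa [mul_one] at this
  · have := apply_eq_of_borel_invariant hf g 1 hc
    rw [key, mul_one] at this
    exact this

/-- If the `ψ_c`-coinvariants were zero, every function in the image of `τ` would have the mean
value property on the projective line, hence be constant. Then `τ` would act trivially, since it
embeds in these functions. -/
theorem nontrivial_jacquetSpace_of_isSteinberg [Fintype F] {V : Type*} [AddCommGroup V]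
    [Module ℂ V] {τ : Representation ℂ (SL2 F) V} (hτ : IsSteinberg τ) {ψ₀ : AddChar F ℂ}
    (hψ₀ : ψ₀ ≠ 1) {c : F} (hc : c ≠ 0) :
    Nontrivial (JacquetSpace τ (N11 F) (psiN11 ψ₀ c)) := by
  classical
  obtain ⟨hnt, i, hi⟩ := hτ
  by_contra hsub
  rw [not_nontrivial_iff_subsingleton, Submodule.Quotient.subsingleton_iff,
    ← ker_twistProj, LinearMap.ker_eq_top] at hsub
  have hi' : ∀ (g : SL2 F) (v : V) (x : SL2 F), (i (τ g v)).1 x = (i v).1 (x * g) := by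
    intro g v x
    rw [Representation.IntertwiningMap.isIntertwining]
    rfl
  have hB : ∀ (v : V), ∀ b ∈ borel F, ∀ g, (i v).1 (b * g) = (i v).1 g := by
    intro v b hb g
    have := (i v).2 ⟨b, hb⟩ g
    rw [charRep_apply] at this
    simpa using this
  have hsum : ∀ (a : F → ℂ) (w : F → V) (x : SL2 F),
      (i (∑ u : F, a u • w u)).1 x = ∑ u : F, a u * (i (w u)).1 x := by
    intro a w x
    rw [map_sum, AddSubmonoidClass.coe_finsetSum, Finset.sum_apply]
    refine Finset.sum_congr rfl fun u _ => ?_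
    rw [map_smul]
    rfl
  have hzero : ∀ (v : V) (x : SL2 F), ∑ u : F, ψ₀ (-(c * u)) * (i v).1 (x * unip u) = 0 := by
    intro v x
    have := Fintype.ofFinite (N11 F)
    have h1 : ∑ u : F, ψ₀ (-(c * u)) • τ (unip u) v = 0 := by
      have h2 := LinearMap.congr_fun hsub v
      rw [twistProj_apply, ← Equiv.sum_comp unipEquiv] at h2
      rw [← LinearMap.zero_apply (σ₁₂ := RingHom.id ℂ) v, ← h2]
      refine Finset.sum_congr rfl fun u _ => ?_
      have h3 : (unipEquiv u : N11 F)⁻¹ = unipN (-u) := by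
        rw [inv_eq_iff_mul_eq_one]
        change unipN u * unipN (-u) = 1
        rw [← unipN_add, add_neg_cancel, unipN_zero]
      rw [h3, psiN11_unipN, mul_neg]
      rfl
    have h4 := hsum (fun u => ψ₀ (-(c * u))) (fun u => τ (unip u) v) x
    rw [h1, map_zero] at h4
    simp only [hi'] at h4
    exact h4.symm
  have hharm : ∀ (v : V), (Fintype.card F : ℂ) * (i v).1 1 =
      ∑ u : F, (i v).1 (antidiag 1 * unip u) := by
    intro v
    -- The average over `N₁₁` takes one value on the big cell and one at the base point. The mean
    -- value property for `v` at `1` says exactly that these two values agree.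
    let w : V := ∑ u : F, (1 : ℂ) • τ (unip u) v
    have hw : ∀ x, (i w).1 x = ∑ u : F, (i v).1 (x * unip u) := fun x => by
      rw [hsum]; simp [hi']
    have hw1 : (i w).1 1 = (Fintype.card F : ℂ) * (i v).1 1 := by
      rw [hw, Finset.sum_congr rfl fun u _ => ?_, Finset.sum_const, nsmul_eq_mul,
        Finset.card_univ]
      have := hB v (unip u) (unip_mem_borel _) 1
      rwa [mul_one, ← one_mul (unip u)] at this
    have hwN : ∀ (x : SL2 F) (z : F), (i w).1 (x * unip z) = (i w).1 x := by
      intro x z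
      rw [hw, hw]
      refine Fintype.sum_equiv (Equiv.addLeft z) _ _ fun u => ?_
      rw [mul_assoc, ← unip_add]; rfl
    -- After translation by `antidiag 1` the argument falls in the Borel subgroup only for `u = 0`.
    -- The character sum kills the constant part, leaving the difference of the two values of `w`.
    have h1 := hzero (τ (antidiag 1) w) (antidiag 1)
    simp only [hi'] at h1
    have h2 : ∀ u : F, (i w).1 (antidiag 1 * unip u * antidiag 1) =
        (i w).1 (antidiag 1) + if u = 0 then (i w).1 1 - (i w).1 (antidiag 1) else 0 := by
      intro u
      have hm := antidiag_mul_unip_mul_antidiag u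
      split_ifs with hu
      · have := hB w (antidiag 1 * unip u * antidiag 1)
          ((congrFun (congrFun hm 1) 0).trans (by simpa using hu)) 1
        rw [mul_one] at this
        rw [this]; ring
      · have := apply_eq_of_borel_invariant (hB w) (antidiag 1 * unip u * antidiag 1) 1
          (by rw [hm]; simpa using hu)
        rw [mul_one, mul_one, hwN] at this
        rw [this, add_zero]
    have h3 : ∑ u : F, ψ₀ (-(c * u)) = 0 := by
      have h4 := AddChar.sum_mulShift (-c) (AddChar.IsPrimitive.of_ne_one hψ₀)
      rw [if_neg (neg_ne_zero.2 hc)] at h4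
      rw [← Nat.cast_zero, ← h4]
      exact Finset.sum_congr rfl fun u _ => by rw [mul_neg, mul_comm]
    simp only [h2, mul_add, Finset.sum_add_distrib, ← Finset.sum_mul, h3, mul_ite, mul_zero,
      Finset.sum_ite_eq', Finset.mem_univ, if_true] at h1
    simp only [neg_zero, AddChar.map_zero_eq_one, zero_mul, zero_add, one_mul] at h1
    rw [← hw1, sub_eq_zero.1 h1, hw]
  have hconst : ∀ (v : V) (g : SL2 F), (i v).1 g = (i v).1 1 := by
    intro v g
    refine eq_const_of_forall_sum_eq (hB v) (fun g => ?_) g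
    have := hharm (τ g v)
    simp only [hi', one_mul] at this
    exact this
  refine hnt ⟨fun g => LinearMap.ext fun v => hi ?_⟩
  ext x
  change (i (τ g v)).1 x = (i v).1 x
  rw [hi', hconst v, hconst v x]

end Steinberg

/-! ### Counting characters in a cuspidal representation -/

section Cuspidal

variable {F : Type*} [Field F] [Fintype F] {V : Type*} [AddCommGroup V] [Module ℂ V]
  (τ : Representation ℂ (SL2 F) V)

/-- This is Fourier inversion on `N₁₁`: by orthogonality of characters, the sum of the unnormalized
projectors over all `c` is multiplication by `q`. -/
theorem eq_zero_of_forall_mem_twistedKer {ψ₀ : AddChar F ℂ} (hψ₀ : ψ₀ ≠ 1) {v : V}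
    (h : ∀ c : F, v ∈ twistedKer τ (N11 F) (psiN11 ψ₀ c)) : v = 0 := by
  classical
  have := Fintype.ofFinite (N11 F)
  have h1 : ∑ c : F, twistProj τ (N11 F) (psiN11 ψ₀ c) v = 0 :=
    Finset.sum_eq_zero fun c _ => by
      have := h c
      rwa [← ker_twistProj, LinearMap.mem_ker] at this
  simp only [twistProj_apply] at h1
  rw [Finset.sum_comm, ← Equiv.sum_comp unipEquiv] at h1
  have h2 : ∀ u : F, ∑ c : F, psiN11 ψ₀ c (unipEquiv u)⁻¹ • τ ((unipEquiv u : N11 F) : SL2 F) v =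
      if u = 0 then (Fintype.card F : ℂ) • v else 0 := by
    intro u
    have h3 : (unipEquiv u : N11 F)⁻¹ = unipN (-u) := by
      rw [inv_eq_iff_mul_eq_one]
      change unipN u * unipN (-u) = 1
      rw [← unipN_add, add_neg_cancel, unipN_zero]
    simp only [h3, psiN11_unipN, ← Finset.sum_smul]
    rw [AddChar.sum_mulShift (-u) (AddChar.IsPrimitive.of_ne_one hψ₀)]
    by_cases hu : u = 0
    · subst hu
      have : ((unipEquiv (0 : F) : N11 F) : SL2 F) = 1 := unip_zero
      simp [this]
    · simp [hu]
  rw [Finset.sum_congr rfl fun u _ => h2 u] at h1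
  simpa using h1

/-- The space `V` embeds in the product of its coinvariants over all `q` characters. The trivial one
contributes `0` by cuspidality and the others at most `1` each, so one more vanishing would force
dimension at most `q - 2`. -/
theorem nontrivial_jacquetSpace_of_isCuspidal [τ.IsIrreducible] (hτ : IsCuspidal τ)
    (hdim : Module.finrank ℂ V + 1 = Fintype.card F) {ψ₀ : AddChar F ℂ} (hψ₀ : ψ₀ ≠ 1)
    {c : F} (hc : c ≠ 0) : Nontrivial (JacquetSpace τ (N11 F) (psiN11 ψ₀ c)) := by
  classical
  have hfd := finiteDimensional_of_isIrreducible τ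
  let Φ : V →ₗ[ℂ] ∀ a : F, JacquetSpace τ (N11 F) (psiN11 ψ₀ a) :=
    LinearMap.pi fun a => (twistedKer τ (N11 F) (psiN11 ψ₀ a)).mkQ
  have hΦ : Function.Injective Φ := by
    rw [← LinearMap.ker_eq_bot, LinearMap.ker_eq_bot']
    intro v hv
    exact eq_zero_of_forall_mem_twistedKer τ hψ₀ fun a =>
      (Submodule.Quotient.mk_eq_zero _).1 (congrFun hv a)
  have h1 := LinearMap.finrank_le_finrank_of_injective hΦ
  rw [Module.finrank_pi_fintype] at h1
  by_contra hno
  rw [not_nontrivial_iff_subsingleton] at hno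
  have h2 : ∀ a : F, Module.finrank ℂ (JacquetSpace τ (N11 F) (psiN11 ψ₀ a)) ≤
      if a ∈ (Finset.univ \ {0, c} : Finset F) then 1 else 0 := by
    intro a
    split_ifs with ha
    · refine finrank_jacquetSpace_le_one τ (psiN11_ne_one hψ₀ fun h0 => ?_)
      simp [h0] at ha
    · rw [Nat.le_zero]
      have : Subsingleton (JacquetSpace τ (N11 F) (psiN11 ψ₀ a)) := by
        simp only [Finset.mem_sdiff, Finset.mem_univ, true_and, not_not, Finset.mem_insert,
          Finset.mem_singleton] at ha
        rcases ha with rfl | rfl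
        · rw [psiN11_zero]; exact hτ
        · exact hno
      exact Module.finrank_zero_of_subsingleton
  have h3 := h1.trans (Finset.sum_le_sum fun a _ => h2 a)
  have h4 : (∑ a : F, if a ∈ (Finset.univ \ {0, c} : Finset F) then 1 else 0) + 2 =
      Fintype.card F := by
    rw [Finset.sum_ite_mem, Finset.univ_inter, Finset.sum_const, smul_eq_mul, mul_one,
      Finset.card_sdiff_of_subset (Finset.subset_univ _), Finset.card_pair hc.symm,
      Finset.card_univ]
    have := Fintype.one_lt_card (α := F)
    omega
  omega

end Cuspidal

/-! ### Explicit elements of `Sp₄` and the cosets of the Klingen parabolic -/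

section Sp4Elements

variable {F : Type*} [Field F]

instance finite_Sp4 [Finite F] : Finite (Sp4 F) :=
  inferInstanceAs (Finite {A : Matrix (Fin 2 ⊕ Fin 2) (Fin 2 ⊕ Fin 2) F //
    A ∈ Matrix.symplecticGroup (Fin 2) F})

/-- The matrix entries of an element of `Sp₄`. -/
abbrev entries (g : Sp4 F) : Matrix (Fin 2 ⊕ Fin 2) (Fin 2 ⊕ Fin 2) F := g

/-- The element of `N` with upper right block `[a, b; b, c]`. -/
def siegelU (a b c : F) : Sp4 F :=
  ⟨Matrix.fromBlocks 1 !![a, b; b, c] 0 1, by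
    rw [SymplecticGroup.fromBlocks_mem_iff]
    refine ⟨by simp, ?_, by simp⟩
    ext i j; fin_cases i <;> fin_cases j <;> simp⟩

theorem siegelU_mem (a b c : F) : siegelU a b c ∈ siegelN F :=
  ⟨_, by ext i j; fin_cases i <;> fin_cases j <;> simp, rfl⟩

theorem exists_siegelU (u : siegelN F) : ∃ a b c : F, u = ⟨siegelU a b c, siegelU_mem a b c⟩ := by
  obtain ⟨u, X, hX, hu⟩ := u
  refine ⟨X 0 0, X 0 1, X 1 1, Subtype.ext (Subtype.ext (hu.trans ?_))⟩
  change _ = Matrix.fromBlocks 1 _ 0 1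
  congr 1
  have h10 := hX.apply 0 1
  ext i j; fin_cases i <;> fin_cases j <;> simp [h10]

theorem psiC_siegelU (ψ₀ : AddChar F ℂ) (γ : Fˣ) (a b c : F) :
    psiC ψ₀ γ ⟨siegelU a b c, siegelU_mem a b c⟩ = ψ₀ (γ * a) := by
  change ψ₀ (matC γ * (Matrix.fromBlocks 1 !![a, b; b, c] 0 1).toBlocks₁₂).trace = _
  rw [Matrix.toBlocks_fromBlocks₁₂]
  simp [matC, Matrix.trace_fin_two]

/-- The permutation matrix exchanging the two coordinates. -/
def swapGL (F : Type*) [Field F] : GL (Fin 2) F :=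
  ⟨!![0, 1; 1, 0], !![0, 1; 1, 0],
    by ext i j; fin_cases i <;> fin_cases j <;> simp [Matrix.mul_apply, Fin.sum_univ_two],
    by ext i j; fin_cases i <;> fin_cases j <;> simp [Matrix.mul_apply, Fin.sum_univ_two]⟩

/-- The Weyl group element exchanging `e₁` with `e₂`, and `e₁^∨` with `e₂^∨`. -/
def weylW (F : Type*) [Field F] : Sp4 F := siegelLevi (swapGL F)

/-- The Weyl group element exchanging `e₁` with `e₁^∨` up to sign. -/
def weylS (F : Type*) [Field F] : Sp4 F :=
  ⟨Matrix.fromBlocks !![0, 0; 0, 1] !![1, 0; 0, 0] !![-1, 0; 0, 0] !![0, 0; 0, 1], by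
    rw [SymplecticGroup.fromBlocks_mem_iff]
    refine ⟨?_, ?_, ?_⟩ <;>
    · ext i j; fin_cases i <;> fin_cases j <;> simp [Matrix.mul_apply, Fin.sum_univ_two]⟩

theorem entries_mul (g h : Sp4 F) : entries (g * h) = entries g * entries h := rfl

theorem entries_mul_apply (g h : Sp4 F) (i j : Fin 2 ⊕ Fin 2) :
    entries (g * h) i j = entries g i (Sum.inl 0) * entries h (Sum.inl 0) j +
      entries g i (Sum.inl 1) * entries h (Sum.inl 1) j +
      (entries g i (Sum.inr 0) * entries h (Sum.inr 0) j +
      entries g i (Sum.inr 1) * entries h (Sum.inr 1) j) := by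
  simp [Matrix.mul_apply, Fintype.sum_sum_type, Fin.sum_univ_two]

theorem entries_siegelU (a b c : F) :
    entries (siegelU a b c) = Matrix.fromBlocks 1 !![a, b; b, c] 0 1 := rfl

theorem entries_siegelLevi (h : GL (Fin 2) F) :
    entries (siegelLevi h) = Matrix.fromBlocks (h : Matrix (Fin 2) (Fin 2) F) 0 0
      ((h⁻¹ : GL (Fin 2) F) : Matrix (Fin 2) (Fin 2) F)ᵀ := rfl

theorem entries_weylW : entries (weylW F) =
    Matrix.fromBlocks !![0, 1; 1, 0] 0 0 !![0, 1; 1, 0]ᵀ := rfl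

theorem entries_weylS : entries (weylS F) =
    Matrix.fromBlocks !![0, 0; 0, 1] !![1, 0; 0, 0] !![-1, 0; 0, 0] !![0, 0; 0, 1] := rfl

theorem entries_inv (g : Sp4 F) :
    entries g⁻¹ = -Matrix.J (Fin 2) F * (entries g)ᵀ * Matrix.J (Fin 2) F :=
  SymplecticGroup.coe_inv g

theorem entries_inv_col (g : Sp4 F) (i : Fin 2) :
    entries g⁻¹ (Sum.inl i) (Sum.inl 0) = entries g (Sum.inr 0) (Sum.inr i) ∧
    entries g⁻¹ (Sum.inr i) (Sum.inl 0) = - entries g (Sum.inr 0) (Sum.inl i) := by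
  rw [entries_inv]
  constructor <;>
  simp [Matrix.mul_apply, Matrix.J, Fintype.sum_sum_type, Matrix.one_apply]

theorem sp4_ext {g h : Sp4 F} (H : ∀ i j, entries g i j = entries h i j) : g = h :=
  Subtype.ext (Matrix.ext H)

theorem weylW_mul_siegelU (a b c : F) :
    weylW F * siegelU a b c = siegelU c b a * weylW F := by
  apply sp4_ext
  intro i j
  rw [entries_mul_apply, entries_mul_apply, entries_weylW, entries_siegelU, entries_siegelU]
  rcases i with i | i <;> rcases j with j | j <;> fin_cases i <;> fin_cases j <;> simp

theorem weylS_mul_siegelU (c : F) :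
    weylS F * siegelU 0 0 c = siegelU 0 0 c * weylS F := by
  apply sp4_ext
  intro i j
  rw [entries_mul_apply, entries_mul_apply, entries_weylS, entries_siegelU]
  rcases i with i | i <;> rcases j with j | j <;> fin_cases i <;> fin_cases j <;> simp

/-- By the symplectic relation, the first column of `q⁻¹` is, up to order and signs, the row `inr 0`
of `q`; so `q⁻¹` stabilizes the line of `e₁`. -/
theorem mem_klingen_of_row {q : Sp4 F}
    (h : ∀ j, j ≠ Sum.inr 0 → entries q (Sum.inr 0) j = 0) : q ∈ klingen F := by
  have hne : entries q (Sum.inr 0) (Sum.inr 0) ≠ 0 := by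
    intro h0
    have h1 := entries_mul_apply q q⁻¹ (Sum.inr 0) (Sum.inr 0)
    rw [mul_inv_cancel, h0, h _ (by simp), h _ (by simp), h _ (by simp)] at h1
    simp [entries] at h1
  rw [← inv_mem_iff]
  refine ⟨Units.mk0 _ hne, ?_⟩
  change entries q⁻¹ *ᵥ _ = _
  ext i
  simp only [e1, Matrix.mulVec_single_one, Matrix.col_apply]
  rcases i with i | i <;> fin_cases i
  · simp [(entries_inv_col q 0).1]
  · simp [(entries_inv_col q 1).1, h]
  · simp [(entries_inv_col q 0).2, h]
  · simp [(entries_inv_col q 1).2, h]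

/-- Cosets of `Q` thus become rows up to scaling, and all double coset computations reduce to
comparing rows. -/
theorem mul_inv_mem_klingen_iff {g h : Sp4 F} : g * h⁻¹ ∈ klingen F ↔
    ∃ t : Fˣ, ∀ j, entries g (Sum.inr 0) j = t * entries h (Sum.inr 0) j := by
  constructor
  · intro hq
    have hrow := klingen_row ⟨_, hq⟩
    have h1 : ∀ j, entries g (Sum.inr 0) j =
        entries (g * h⁻¹) (Sum.inr 0) (Sum.inr 0) * entries h (Sum.inr 0) j := by
      intro j
      have h2 := entries_mul_apply (g * h⁻¹) h (Sum.inr 0) j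
      rw [inv_mul_cancel_right] at h2
      rw [h2]
      have h3 : ∀ k, k ≠ Sum.inr 0 → entries (g * h⁻¹) (Sum.inr 0) k = 0 := hrow
      rw [h3 (Sum.inl 0) (by simp), h3 (Sum.inl 1) (by simp), h3 (Sum.inr 1) (by simp)]
      ring
    have hne : entries (g * h⁻¹) (Sum.inr 0) (Sum.inr 0) ≠ 0 := by
      intro h0
      have h2 := entries_mul_apply g g⁻¹ (Sum.inr 0) (Sum.inr 0)
      rw [mul_inv_cancel] at h2
      simp only [h1, h0] at h2
      simp [entries] at h2
    exact ⟨Units.mk0 _ hne, h1⟩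
  · rintro ⟨t, ht⟩
    apply mem_klingen_of_row
    intro j hj
    have h1 := entries_mul_apply h h⁻¹ (Sum.inr 0) j
    rw [entries_mul_apply]
    simp only [ht]
    rw [mul_inv_cancel] at h1
    have h2 : entries (1 : Sp4 F) (Sum.inr 0) j = 0 := by
      simp [entries, hj.symm]
    rw [h2] at h1
    linear_combination (-(t : F)) * h1

theorem row_mul_siegelU (g : Sp4 F) (a b c : F) :
    (∀ j, entries (g * siegelU a b c) (Sum.inr 0) (Sum.inl j) = entries g (Sum.inr 0) (Sum.inl j)) ∧
    entries (g * siegelU a b c) (Sum.inr 0) (Sum.inr 0) =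
      entries g (Sum.inr 0) (Sum.inl 0) * a + entries g (Sum.inr 0) (Sum.inl 1) * b +
        entries g (Sum.inr 0) (Sum.inr 0) ∧
    entries (g * siegelU a b c) (Sum.inr 0) (Sum.inr 1) =
      entries g (Sum.inr 0) (Sum.inl 0) * b + entries g (Sum.inr 0) (Sum.inl 1) * c +
        entries g (Sum.inr 0) (Sum.inr 1) := by
  refine ⟨fun j => ?_, ?_, ?_⟩
  · rw [entries_mul_apply, entries_siegelU]
    fin_cases j <;> simp
  · rw [entries_mul_apply, entries_siegelU]
    simp
  · rw [entries_mul_apply, entries_siegelU]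
    simp

theorem row_weylW : entries (weylW F) (Sum.inr 0) = Sum.elim ![0, 0] ![0, 1] := by
  rw [entries_weylW]
  ext i
  rcases i with i | i <;> fin_cases i <;> simp

theorem row_weylS : entries (weylS F) (Sum.inr 0) = Sum.elim ![-1, 0] ![0, 0] := by
  rw [entries_weylS]
  ext i
  rcases i with i | i <;> fin_cases i <;> simp

theorem row_weylS_mul_weylW_mul_siegelLevi (h : GL (Fin 2) F) :
    entries (weylS F * weylW F * siegelLevi h) (Sum.inr 0) =
      Sum.elim ![-h.1 1 0, -h.1 1 1] ![0, 0] := by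
  ext i
  rw [entries_mul_apply, entries_siegelLevi]
  simp only [entries_mul_apply, entries_weylS, entries_weylW]
  rcases i with i | i <;> fin_cases i <;> simp

theorem row_siegelLevi (h : GL (Fin 2) F) :
    entries (siegelLevi h) (Sum.inr 0) = Sum.elim ![0, 0] ![h⁻¹.1 0 0, h⁻¹.1 1 0] := by
  rw [entries_siegelLevi]
  ext i
  rcases i with i | i <;> fin_cases i <;> simp

theorem GL_mul_inv_apply (h : GL (Fin 2) F) (i j : Fin 2) :
    h.1 i 0 * h⁻¹.1 0 j + h.1 i 1 * h⁻¹.1 1 j = (1 : Matrix (Fin 2) (Fin 2) F) i j := by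
  have h1 : h.1 * h⁻¹.1 = 1 := h.mul_inv
  rw [← h1, Matrix.mul_apply, Fin.sum_univ_two]

theorem GL_inv_lower (h : GL (Fin 2) F) (a d : Fˣ) (ha : h.1 0 0 = a) (hd : h.1 1 1 = d)
    (h01 : h.1 0 1 = 0) :
    h⁻¹.1 0 0 = ((a⁻¹ : Fˣ) : F) ∧ h⁻¹.1 1 1 = ((d⁻¹ : Fˣ) : F) ∧ h⁻¹.1 0 1 = 0 := by
  have e00 := GL_mul_inv_apply h 0 0
  have e01 := GL_mul_inv_apply h 0 1
  have e11 := GL_mul_inv_apply h 1 1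
  have ha0 := a.ne_zero
  have hd0 := d.ne_zero
  generalize h⁻¹.1 = k at *
  simp [h01, ha, hd] at e00 e01 e11
  simp [e01] at e11
  exact ⟨by rw [Units.val_inv_eq_inv_val]; exact eq_inv_of_mul_eq_one_right e00,
    by rw [Units.val_inv_eq_inv_val]; exact eq_inv_of_mul_eq_one_right e11, e01⟩

theorem GL_inv_upper (h : GL (Fin 2) F) (a d : Fˣ) (ha : h.1 0 0 = a) (hd : h.1 1 1 = d)
    (h10 : h.1 1 0 = 0) :
    h⁻¹.1 0 0 = ((a⁻¹ : Fˣ) : F) ∧ h⁻¹.1 1 1 = ((d⁻¹ : Fˣ) : F) ∧ h⁻¹.1 1 0 = 0 := by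
  have e00 := GL_mul_inv_apply h 0 0
  have e10 := GL_mul_inv_apply h 1 0
  have e11 := GL_mul_inv_apply h 1 1
  have ha0 := a.ne_zero
  have hd0 := d.ne_zero
  generalize h⁻¹.1 = k at *
  simp [h10, ha, hd] at e00 e10 e11
  simp [e10] at e00
  exact ⟨by rw [Units.val_inv_eq_inv_val]; exact eq_inv_of_mul_eq_one_right e00,
    by rw [Units.val_inv_eq_inv_val]; exact eq_inv_of_mul_eq_one_right e11, e10⟩

end Sp4Elements

/-! ### Equivariance under the Siegel Levi at the Weyl representatives -/

section KlingenAction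

variable {F : Type*} [Field F] {V : Type*} [AddCommGroup V] [Module ℂ V] (η : Fˣ →* ℂˣ)
  (τ : Representation ℂ (SL2 F) V)

theorem klingenInflation_apply (q : klingen F) (t : Fˣ) (A : SL2 F)
    (ht : entries (q : Sp4 F) (Sum.inl 0) (Sum.inl 0) = t)
    (hA : middleBlock (entries (q : Sp4 F)) = A.1) (v : V) :
    klingenInflation η τ q v = (η t : ℂ) • τ A v := by
  have h1 : klingenGL1 q = t := Units.ext ht
  have h2 : klingenSL2 q = A := Subtype.ext hA
  change ((η (klingenGL1 q) : ℂˣ) : ℂ) • τ (klingenSL2 q) v = _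
  rw [h1, h2]

theorem siegelU_mem_klingen (a b c : F) : siegelU a b c ∈ klingen F := by
  apply mem_klingen_of_row
  intro j hj
  rw [entries_siegelU]
  rcases j with j | j <;> fin_cases j <;> simp at hj ⊢

theorem klingenInflation_siegelU (a b c : F) (h : siegelU a b c ∈ klingen F) (v : V) :
    klingenInflation η τ ⟨siegelU a b c, h⟩ v = τ (unip c) v := by
  rw [klingenInflation_apply η τ _ 1 (unip c)]
  · simp
  · simp [entries_siegelU]
  · simp [entries_siegelU, middleBlock, unip]

variable {η τ} (f : Representation.coindV (klingen F).subtype (klingenInflation η τ))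

theorem coindV_siegelU_mul (a b c : F) (g : Sp4 F) :
    f.1 (siegelU a b c * g) = τ (unip c) (f.1 g) := by
  rw [← klingenInflation_siegelU η τ a b c (siegelU_mem_klingen a b c)]
  exact coindV_mul f ⟨_, siegelU_mem_klingen a b c⟩ g

theorem coindV_upper_mul (h : GL (Fin 2) F) (a d : Fˣ) (ha : h.1 0 0 = a) (hd : h.1 1 1 = d)
    (h10 : h.1 1 0 = 0) (g : Sp4 F) :
    f.1 (siegelLevi h * g) = (η a : ℂ) • τ (torus d) (f.1 g) := by
  obtain ⟨-, i11, i10⟩ := GL_inv_upper h a d ha hd h10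
  have hq : siegelLevi h ∈ klingen F := by
    apply mem_klingen_of_row
    intro j hj
    rw [row_siegelLevi]
    rcases j with j | j <;> fin_cases j <;> simp at hj ⊢
    simpa using i10
  rw [← klingenInflation_apply η τ ⟨_, hq⟩ a (torus d) ?_ ?_]
  · exact coindV_mul f ⟨_, hq⟩ g
  · simpa [entries_siegelLevi] using ha
  · rw [coe_torus, ← hd, ← i11]
    simp [entries_siegelLevi, middleBlock]

theorem entries_weylS_conj (h : GL (Fin 2) F) : entries (weylS F * siegelLevi h * (weylS F)⁻¹) =
    Matrix.fromBlocks !![h⁻¹.1 0 0, 0; 0, h.1 1 1] !![0, h⁻¹.1 1 0; -h.1 1 0, 0]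
      !![0, -h.1 0 1; h⁻¹.1 0 1, 0] !![h.1 0 0, 0; 0, h⁻¹.1 1 1] := by
  rw [← sub_eq_zero]
  have h1 : entries (weylS F * siegelLevi h) = (Matrix.fromBlocks !![h⁻¹.1 0 0, 0; 0, h.1 1 1]
      !![0, h⁻¹.1 1 0; -h.1 1 0, 0] !![0, -h.1 0 1; h⁻¹.1 0 1, 0]
      !![h.1 0 0, 0; 0, h⁻¹.1 1 1]) * entries (weylS F) := by
    rw [entries_mul, entries_weylS, entries_siegelLevi, Matrix.fromBlocks_multiply,
      Matrix.fromBlocks_multiply]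
    congr 1 <;>
    · ext i j
      fin_cases i <;> fin_cases j <;> simp [Matrix.vecMul, dotProduct]
  have h2 : entries (weylS F) * entries (weylS F)⁻¹ = 1 := by
    rw [← entries_mul, mul_inv_cancel]; rfl
  rw [entries_mul, h1, mul_assoc, h2, mul_one, sub_self]

/-- Conjugation by `s` sends a lower triangular Levi element into `Q`. It inverts the coordinate
`a`, and the lower left entry lands in the unipotent radical of `Q`, where it has no effect. -/
theorem coindV_weylS_mul (h : GL (Fin 2) F) (a d : Fˣ) (ha : h.1 0 0 = a) (hd : h.1 1 1 = d)
    (h01 : h.1 0 1 = 0) (g : Sp4 F) :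
    f.1 (weylS F * siegelLevi h * g) = (η a⁻¹ : ℂ) • τ (torus d) (f.1 (weylS F * g)) := by
  obtain ⟨i00, i11, i01⟩ := GL_inv_lower h a d ha hd h01
  have hq : weylS F * siegelLevi h * (weylS F)⁻¹ ∈ klingen F := by
    apply mem_klingen_of_row
    intro j hj
    rw [entries_weylS_conj]
    rcases j with j | j <;> fin_cases j <;> simp [h01] at hj ⊢
  rw [← klingenInflation_apply η τ ⟨_, hq⟩ a⁻¹ (torus d) ?_ ?_]
  · rw [← coindV_mul f ⟨_, hq⟩]
    simp [mul_assoc]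
  · rw [entries_weylS_conj, ← i00]
    simp
  · rw [entries_weylS_conj, coe_torus, ← hd, ← i11]
    simp only [middleBlock]
    simp only [h01, i01, Matrix.fromBlocks_apply₁₁, Matrix.fromBlocks_apply₁₂,
      Matrix.fromBlocks_apply₂₁, Matrix.fromBlocks_apply₂₂]
    simp

theorem weylW_mul_siegelLevi (h : GL (Fin 2) F) :
    weylW F * siegelLevi h = siegelLevi (swapGL F * h * (swapGL F)⁻¹) * weylW F := by
  rw [weylW, ← map_mul, ← map_mul]
  simp

theorem swapGL_conj (h : GL (Fin 2) F) :
    (swapGL F * h * (swapGL F)⁻¹).1 = !![h.1 1 1, h.1 1 0; h.1 0 1, h.1 0 0] := by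
  change !![0, 1; 1, 0] * h.1 * !![0, 1; 1, 0] = _
  ext i j
  fin_cases i <;> fin_cases j <;> simp [Matrix.mul_apply, Fin.sum_univ_two, Matrix.vecMul,
    dotProduct]

theorem coindV_weylW_mul (h : GL (Fin 2) F) (a d : Fˣ) (ha : h.1 0 0 = a) (hd : h.1 1 1 = d)
    (h01 : h.1 0 1 = 0) (g : Sp4 F) :
    f.1 (weylW F * siegelLevi h * g) = (η d : ℂ) • τ (torus a) (f.1 (weylW F * g)) := by
  rw [weylW_mul_siegelLevi, mul_assoc]
  apply coindV_upper_mul <;> rw [swapGL_conj] <;> simp [ha, hd, h01]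

theorem coindV_weylS_mul_weylW_mul (h : GL (Fin 2) F) (a d : Fˣ) (ha : h.1 0 0 = a)
    (hd : h.1 1 1 = d) (h10 : h.1 1 0 = 0) (g : Sp4 F) :
    f.1 (weylS F * weylW F * siegelLevi h * g) =
      (η d⁻¹ : ℂ) • τ (torus a) (f.1 (weylS F * weylW F * g)) := by
  rw [mul_assoc (weylS F), weylW_mul_siegelLevi, ← mul_assoc, mul_assoc _ (weylW F),
    mul_assoc (weylS F) (weylW F)]
  apply coindV_weylS_mul <;> rw [swapGL_conj] <;> simp [ha, hd, h10]

end KlingenAction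

/-! ### Equivariant functions are determined on the relevant double cosets -/

section Injectivity

variable {F : Type*} [Field F] {V : Type*} [AddCommGroup V] [Module ℂ V] {η : Fˣ →* ℂˣ}
  {τ : Representation ℂ (SL2 F) V}

/-- The matrix with rows `(1, 0)` and `(y, d)`. -/
def lowerGL (y : F) (d : Fˣ) : GL (Fin 2) F :=
  ⟨!![1, 0; y, (d : F)], !![1, 0; -((d⁻¹ : Fˣ) : F) * y, ((d⁻¹ : Fˣ) : F)],
    by ext i j; fin_cases i <;> fin_cases j <;> simp [Matrix.mul_apply, Fin.sum_univ_two],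
    by ext i j; fin_cases i <;> fin_cases j <;> simp [Matrix.mul_apply, Fin.sum_univ_two]⟩

theorem lowerGL_mem (γ : Fˣ) (y : F) (d : Fˣ) : lowerGL y d ∈ O2 γ := by
  rw [mem_O2_iff]
  simp [lowerGL]

variable (f : Representation.coindV (klingen F).subtype (klingenInflation η τ))

theorem coindV_eq_zero_of_row {g g₀ : Sp4 F} (t : F) (ht : t ≠ 0)
    (hrow : ∀ j, entries g (Sum.inr 0) j = t * entries g₀ (Sum.inr 0) j) (h : f.1 g₀ = 0) :
    f.1 g = 0 := by
  have hq : g * g₀⁻¹ ∈ klingen F := mul_inv_mem_klingen_iff.2 ⟨Units.mk0 t ht, hrow⟩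
  have h1 := coindV_mul f ⟨_, hq⟩ g₀
  rw [h, map_zero] at h1
  simpa using h1

variable {ψ₀ : AddChar F ℂ} {γ : Fˣ}

theorem exists_addChar_ne_one (hψ₀ : ψ₀ ≠ 1) (γ : Fˣ) : ∃ c : F, ψ₀ (γ * c) ≠ 1 := by
  by_contra! h
  apply hψ₀
  ext x
  have := h (((γ⁻¹ : Fˣ) : F) * x)
  simpa using this

/-- The element `siegelU c 0 0` lies in the unipotent radical of `Q`, so it acts trivially from the
left. Moved to the right across the Levi element it acts by `ψ₀(γ c)`, which is not `1` for a
suitable `c`. -/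
theorem coindV_siegelLevi_eq_zero (hψ₀ : ψ₀ ≠ 1)
    (hf : ∀ (g : Sp4 F) (u : siegelN F), f.1 (g * u) = psiC ψ₀ γ u • f.1 g) (h : O2 γ) :
    f.1 (siegelLevi (h : GL (Fin 2) F))⁻¹ = 0 := by
  obtain ⟨c, hc⟩ := exists_addChar_ne_one hψ₀ γ
  obtain ⟨hm1, hm2⟩ := siegelLevi_mem_charStabilizer ψ₀ γ h
  have h1 := hf (siegelLevi (h : GL (Fin 2) F))⁻¹ ⟨_, (hm1 _).1 (siegelU_mem c 0 0)⟩
  rw [hm2 ⟨_, siegelU_mem c 0 0⟩ _ rfl, psiC_siegelU] at h1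
  simp only [← mul_assoc, inv_mul_cancel, one_mul] at h1
  rw [coindV_siegelU_mul, unip_zero, map_one, Module.End.one_apply] at h1
  have h2 : (ψ₀ (γ * c) - 1) • f.1 (siegelLevi (h : GL (Fin 2) F))⁻¹ = 0 := by
    rw [sub_smul, one_smul, ← h1, sub_self]
  exact (smul_eq_zero.1 h2).resolve_left (sub_ne_zero.2 hc)

/-- A `(N, ψ_C)`-equivariant function in the Klingen induced representation is determined by its
values at representatives of the relevant double cosets. -/
theorem coindV_eq_zero (hψ₀ : ψ₀ ≠ 1)
    (hf : ∀ (g : Sp4 F) (u : siegelN F), f.1 (g * u) = psiC ψ₀ γ u • f.1 g)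
    (hw : f.1 (weylW F) = 0) (hs : f.1 (weylS F) = 0)
    (hsw : ∀ h : O2 γ, f.1 (weylS F * weylW F * siegelLevi (h : GL (Fin 2) F)) = 0) : f = 0 := by
  -- Rows `(x, 0)` are multiples of the row of `s` when `x₁ = 0`. Otherwise they are multiples of
  -- the row of `s w h`, with `h` in `O₂` having second row `x`.
  have hy0 : ∀ g : Sp4 F, entries g (Sum.inr 0) (Sum.inr 0) = 0 →
      entries g (Sum.inr 0) (Sum.inr 1) = 0 → f.1 g = 0 := by
    intro g h0 h1
    by_cases hx1 : entries g (Sum.inr 0) (Sum.inl 1) = 0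
    · refine coindV_eq_zero_of_row f (g₀ := weylS F) (-entries g (Sum.inr 0) (Sum.inl 0)) ?_ ?_ hs
      · intro hx0
        have h2 := entries_mul_apply g g⁻¹ (Sum.inr 0) (Sum.inr 0)
        rw [mul_inv_cancel, neg_eq_zero.1 hx0, hx1, h0, h1] at h2
        simp [entries] at h2
      · intro j
        rw [row_weylS]
        rcases j with j | j <;> fin_cases j <;> simp [hx1, h0, h1]
    · refine coindV_eq_zero_of_row f (-1) (by simp) ?_
        (hsw ⟨_, lowerGL_mem γ (entries g (Sum.inr 0) (Sum.inl 0)) (Units.mk0 _ hx1)⟩)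
      intro j
      rw [row_weylS_mul_weylW_mul_siegelLevi]
      rcases j with j | j <;> fin_cases j <;> simp [lowerGL, h0, h1]
  have htrans : ∀ (g : Sp4 F) (a b c : F), f.1 (g * siegelU a b c) = 0 → f.1 g = 0 := by
    intro g a b c h
    have h1 := hf g ⟨_, siegelU_mem a b c⟩
    rw [h] at h1
    exact (smul_eq_zero.1 h1.symm).resolve_left
      (left_ne_zero_of_mul_eq_one (char_mul_char_inv (psiC ψ₀ γ) _))
  ext g
  change f.1 g = 0
  by_cases hx0 : entries g (Sum.inr 0) (Sum.inl 0) = 0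
  · by_cases hx1 : entries g (Sum.inr 0) (Sum.inl 1) = 0
    · by_cases hy : entries g (Sum.inr 0) (Sum.inr 0) = 0
      · refine coindV_eq_zero_of_row f (g₀ := weylW F) (entries g (Sum.inr 0) (Sum.inr 1)) ?_ ?_ hw
        · intro hy1
          have h2 := entries_mul_apply g g⁻¹ (Sum.inr 0) (Sum.inr 0)
          rw [mul_inv_cancel, hx0, hx1, hy, hy1] at h2
          simp [entries] at h2
        · intro j
          rw [row_weylW]
          rcases j with j | j <;> fin_cases j <;> simp [hx0, hx1, hy]
      -- A row `(0, y)` with `y₀ ≠ 0` is proportional to that of the inverse of the Levi element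
      -- with lower left entry `y₁ / y₀`; this is the inadmissible orbit.
      · refine coindV_eq_zero_of_row f (entries g (Sum.inr 0) (Sum.inr 0)) hy ?_
          (coindV_siegelLevi_eq_zero f hψ₀ hf ⟨_, lowerGL_mem γ
            (entries g (Sum.inr 0) (Sum.inr 1) / entries g (Sum.inr 0) (Sum.inr 0)) 1⟩)
        intro j
        rw [← map_inv, row_siegelLevi, inv_inv]
        rcases j with j | j <;> fin_cases j <;> simp [lowerGL, hx0, hx1]
        field_simp
    · refine htrans g 0 (-entries g (Sum.inr 0) (Sum.inr 0) / entries g (Sum.inr 0) (Sum.inl 1))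
        (-entries g (Sum.inr 0) (Sum.inr 1) / entries g (Sum.inr 0) (Sum.inl 1)) (hy0 _ ?_ ?_)
      · rw [(row_mul_siegelU _ _ _ _).2.1]
        field_simp
        ring
      · rw [(row_mul_siegelU _ _ _ _).2.2, hx0]
        field_simp
        ring
  · let b := -entries g (Sum.inr 0) (Sum.inr 1) / entries g (Sum.inr 0) (Sum.inl 0)
    refine htrans g ((-entries g (Sum.inr 0) (Sum.inr 0) - entries g (Sum.inr 0) (Sum.inl 1) * b) /
      entries g (Sum.inr 0) (Sum.inl 0)) b 0 (hy0 _ ?_ ?_)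
    · rw [(row_mul_siegelU _ _ _ _).2.1]
      field_simp
      ring
    · rw [(row_mul_siegelU _ _ _ _).2.2]
      simp only [b]
      field_simp
      ring

end Injectivity

/-! ### The three-term decomposition of the twisted Jacquet module -/

section Decomposition

variable {F : Type*} [Field F] {V : Type*} [AddCommGroup V] [Module ℂ V]
  {W : Type*} [AddCommGroup W] [Module ℂ W]

/-- A character acting by scalars on the space `W`. -/
abbrev scalarRep {G : Type*} [Group G] (W : Type*) [AddCommGroup W] [Module ℂ W] (χ : G →* ℂˣ) :
    Representation ℂ G W :=
  charTwist χ (Representation.trivial ℂ G W)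

theorem scalarRep_apply {G : Type*} [Group G] (χ : G →* ℂˣ) (g : G) (w : W) :
    scalarRep W χ g w = (χ g : ℂ) • w := rfl

/-- The representation `ω_τ ⊗ η` of `O₂` with multiplicity space `W`. -/
abbrev scalarO2 (W : Type*) [AddCommGroup W] [Module ℂ W] (γ : Fˣ) (η : Fˣ →* ℂˣ)
    (τ : Representation ℂ (SL2 F) V) : Representation ℂ (O2 γ) W :=
  (scalarRep W (t2Char γ (centralCharacter τ) η)).comp (o2ToT2 γ)

/-- The representation `Ind (ω_τ ⊗ η⁻¹)` of `O₂` with multiplicity space `W`. -/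
abbrev scalarInd (W : Type*) [AddCommGroup W] [Module ℂ W] (γ : Fˣ) (η : Fˣ →* ℂˣ)
    (τ : Representation ℂ (SL2 F) V) :=
  induced (T2 γ) (scalarRep W (t2Char γ (centralCharacter τ) η⁻¹))

variable {ψ₀ : AddChar F ℂ} {γ : Fˣ} {η : Fˣ →* ℂˣ}
  {τ : Representation ℂ (SL2 F) V} {lam : V →ₗ[ℂ] W}

theorem map_unip_of_ker (hlam : LinearMap.ker lam = twistedKer τ (N11 F) (psiN11 ψ₀ γ)) (c : F)
    (v : V) : lam (τ (unip c) v) = ψ₀ (γ * c) • lam v := by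
  have h1 : τ (unip c) v - ψ₀ (γ * c) • v ∈ LinearMap.ker lam := by
    rw [hlam]
    exact Submodule.subset_span ⟨unipN c, v, rfl⟩
  rw [LinearMap.mem_ker, map_sub, map_smul, sub_eq_zero] at h1
  exact h1

theorem mkQ_unip (c : F) (v : V) :
    (twistedKer τ (N11 F) 1).mkQ (τ (unip c) v) = (twistedKer τ (N11 F) 1).mkQ v := by
  rw [← sub_eq_zero, ← map_sub, Submodule.mkQ_apply, Submodule.Quotient.mk_eq_zero]
  exact Submodule.subset_span ⟨unipN c, v, by simp [coe_unipN]⟩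

theorem row_weylS_mul_weylW :
    entries (weylS F * weylW F) (Sum.inr 0) = Sum.elim ![0, -1] ![0, 0] := by
  have := row_weylS_mul_weylW_mul_siegelLevi (1 : GL (Fin 2) F)
  rw [map_one, mul_one] at this
  rw [this]
  simp

variable [Finite F]

theorem torus_o2a_apply [τ.IsIrreducible] (t : T2 γ) (v : V) :
    τ (torus (o2a γ (t : O2 γ))) v = (centralCharacter τ (t2ToCenter γ t) : ℂ) • v :=
  centralCharacter_spec τ (t2ToCenter γ t) v

variable (ψ₀ γ η τ) in
/-- The unnormalized projector onto the `(N, ψ_C)`-equivariant functions. -/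
abbrev klingenProj := twistProj (klingenInd η τ) (siegelN F) (psiC ψ₀ γ)

theorem klingenProj_rep (h : O2 γ)
    (f : Representation.coindV (klingen F).subtype (klingenInflation η τ)) (g : Sp4 F) :
    (klingenProj ψ₀ γ η τ (klingenInd η τ (siegelLevi (h : GL (Fin 2) F)) f)).1 g =
      (klingenProj ψ₀ γ η τ f).1 (g * siegelLevi (h : GL (Fin 2) F)) := by
  rw [klingenProj, twistProj_rep_of_mem_charStabilizer _ _ _
    (siegelLevi_mem_charStabilizer ψ₀ γ h)]
  rfl

variable (ψ₀ γ η τ) in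
/-- Evaluation at `g` after projection to the `(N, ψ_C)`-equivariant functions. -/
def klingenEval (g : Sp4 F) :
    Representation.coindV (klingen F).subtype (klingenInflation η τ) →ₗ[ℂ] V :=
  LinearMap.proj g ∘ₗ Submodule.subtype _ ∘ₗ klingenProj ψ₀ γ η τ

theorem klingenEval_apply (g : Sp4 F)
    (f : Representation.coindV (klingen F).subtype (klingenInflation η τ)) :
    klingenEval ψ₀ γ η τ g f = (klingenProj ψ₀ γ η τ f).1 g := rfl

theorem klingenEval_rep (h : O2 γ) (g : Sp4 F)
    (f : Representation.coindV (klingen F).subtype (klingenInflation η τ)) :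
    klingenEval ψ₀ γ η τ g (klingenInd η τ (siegelLevi (h : GL (Fin 2) F)) f) =
      klingenEval ψ₀ γ η τ (g * siegelLevi (h : GL (Fin 2) F)) f :=
  klingenProj_rep h f g

/-- This expresses disjointness of double cosets through rows: no translate by `N` of the row of `g`
is proportional to the row of `g₀`. Since `N` does not change the `x`-part, comparing one coordinate
usually suffices. -/
theorem klingenEval_delta_eq_zero {g g₀ : Sp4 F} (v : V)
    (h : ∀ (a b c : F) (t : Fˣ), ¬ ∀ j, entries (g * siegelU a b c) (Sum.inr 0) j =
      t * entries g₀ (Sum.inr 0) j) :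
    klingenEval ψ₀ γ η τ g (inducedDelta (klingen F) (klingenInflation η τ) g₀ v) = 0 := by
  refine twistProj_delta_eq_zero _ _ _ _ fun u hu hmem => ?_
  obtain ⟨a, b, c, hu'⟩ := exists_siegelU ⟨u, hu⟩
  have hu'' : u = siegelU a b c := congrArg Subtype.val hu'
  obtain ⟨t, ht⟩ := mul_inv_mem_klingen_iff.1 hmem
  rw [hu''] at ht
  exact h a b c t ht

variable (ψ₀ γ η) in
/-- The component of the Jacquet module on the open double cosets. -/
def openComponent [τ.IsIrreducible] (lam : V →ₗ[ℂ] W) :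
    Representation.coindV (klingen F).subtype (klingenInflation η τ) →ₗ[ℂ]
      Representation.coindV (T2 γ).subtype
        (scalarRep W (t2Char γ (centralCharacter τ) η⁻¹)) :=
  LinearMap.codRestrict _
    (LinearMap.pi fun h : O2 γ =>
      lam ∘ₗ klingenEval ψ₀ γ η τ (weylS F * weylW F * siegelLevi (h : GL (Fin 2) F)))
    fun f => by
      rw [Representation.mem_coindV]
      intro t h
      simp only [LinearMap.pi_apply, LinearMap.comp_apply, klingenEval_apply]
      have h1 : siegelLevi (((T2 γ).subtype t * h : O2 γ) : GL (Fin 2) F) =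
        siegelLevi ((t : O2 γ) : GL (Fin 2) F) * siegelLevi (h : GL (Fin 2) F) := map_mul _ _ _
      rw [h1, ← mul_assoc, coindV_weylS_mul_weylW_mul _ _ (o2a γ t) (o2d γ t) rfl rfl t.2,
        torus_o2a_apply, map_smul, map_smul, scalarRep_apply, smul_smul]
      congr 1
      simp [t2Char, mul_comm]

theorem openComponent_apply [τ.IsIrreducible]
    (f : Representation.coindV (klingen F).subtype (klingenInflation η τ)) (h : O2 γ) :
    (openComponent ψ₀ γ η lam f).1 h = lam (klingenEval ψ₀ γ η τ
      (weylS F * weylW F * siegelLevi (h : GL (Fin 2) F)) f) := rfl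

variable (ψ₀ γ η) in
/-- The map inducing the decomposition of the Jacquet module. -/
def decompose [τ.IsIrreducible] (lam : V →ₗ[ℂ] W) :
    Representation.coindV (klingen F).subtype (klingenInflation η τ) →ₗ[ℂ]
      W × JacquetSpace τ (N11 F) 1 × Representation.coindV (T2 γ).subtype
        (scalarRep W (t2Char γ (centralCharacter τ) η⁻¹)) :=
  (lam ∘ₗ klingenEval ψ₀ γ η τ (weylW F)).prod
    (((twistedKer τ (N11 F) 1).mkQ ∘ₗ klingenEval ψ₀ γ η τ (weylS F)).prod
      (openComponent ψ₀ γ η lam))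

variable [τ.IsIrreducible]

theorem decompose_apply (f : Representation.coindV (klingen F).subtype (klingenInflation η τ)) :
    decompose ψ₀ γ η lam f = (lam (klingenEval ψ₀ γ η τ (weylW F) f),
      (twistedKer τ (N11 F) 1).mkQ (klingenEval ψ₀ γ η τ (weylS F) f),
      openComponent ψ₀ γ η lam f) := rfl

/-- The projector commutes with `O₂`, so `h` acts by right translation of the argument. At `w` and
`s` it crosses to the left as an element of `Q`, and `torus a` with `a = ±1` is central. On the open
part it is right translation in the induced representation. -/
theorem decompose_rep (h : O2 γ)
    (f : Representation.coindV (klingen F).subtype (klingenInflation η τ)) :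
    decompose ψ₀ γ η lam (klingenInd η τ (siegelLevi (h : GL (Fin 2) F)) f) =
      (scalarO2 W γ η τ).prod ((rho1 γ η τ).prod (scalarInd W γ η τ)) h
        (decompose ψ₀ γ η lam f) := by
  have h01 := ((mem_O2_iff γ _).1 h.2).2
  rw [decompose_apply, decompose_apply]
  refine Prod.ext ?_ (Prod.ext ?_ ?_)
  · change lam _ = scalarRep W _ (o2ToT2 γ h) (lam _)
    have h1 := coindV_weylW_mul (klingenProj ψ₀ γ η τ f) (h : GL (Fin 2) F) (o2a γ h) (o2d γ h)
      rfl rfl h01 1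
    rw [mul_one, mul_one] at h1
    have h2 : o2a γ h = o2a γ (o2ToT2 γ h : O2 γ) := Units.ext rfl
    have h3 : o2d γ h = o2d γ (o2ToT2 γ h : O2 γ) := Units.ext rfl
    rw [klingenEval_rep, klingenEval_apply, h1, h2, h3, torus_o2a_apply, map_smul, map_smul,
      scalarRep_apply, smul_smul, klingenEval_apply]
    congr 1
    simp [t2Char, mul_comm]
  · change (twistedKer τ (N11 F) 1).mkQ _ = rho1 γ η τ h ((twistedKer τ (N11 F) 1).mkQ _)
    have h1 := coindV_weylS_mul (klingenProj ψ₀ γ η τ f) (h : GL (Fin 2) F) (o2a γ h) (o2d γ h)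
      rfl rfl h01 1
    rw [mul_one, mul_one] at h1
    -- The unit `a = ±1` was constructed as its own inverse, so the `η(a⁻¹)` arising at `s` is the
    -- `η(a)` of `ϱ₁`.
    have h2 : (o2a γ h)⁻¹ = o2a γ h := rfl
    rw [klingenEval_rep, klingenEval_apply, h1, h2, map_smul]
    rfl
  · refine Subtype.ext (funext fun g => ?_)
    change (openComponent ψ₀ γ η lam _).1 g = (openComponent ψ₀ γ η lam f).1 (g * h)
    rw [openComponent_apply, klingenEval_rep, openComponent_apply, mul_assoc, ← map_mul]
    rfl

/-- At each representative the projected function takes a value that is equivariant under the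
relevant character of `N₁₁`. Such a value vanishes as soon as its class in the coinvariants does,
and `coindV_eq_zero` then applies. -/
theorem ker_decompose (hψ₀ : ψ₀ ≠ 1)
    (hlam : LinearMap.ker lam = twistedKer τ (N11 F) (psiN11 ψ₀ γ)) :
    LinearMap.ker (decompose ψ₀ γ η lam) =
      twistedKer (klingenInd η τ) (siegelN F) (psiC ψ₀ γ) := by
  refine Eq.trans ?_ (ker_twistProj (klingenInd η τ) (siegelN F) (psiC ψ₀ γ))
  ext f
  simp only [LinearMap.mem_ker]
  constructor
  · intro hf
    rw [decompose_apply, Prod.mk_eq_zero, Prod.mk_eq_zero] at hf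
    obtain ⟨hW, hS, hO⟩ := hf
    have hN : ∀ (g : Sp4 F) (u : siegelN F), (klingenProj ψ₀ γ η τ f).1 (g * u) =
        psiC ψ₀ γ u • (klingenProj ψ₀ γ η τ f).1 g := twistProj_induced_mul _ _ _ f
    refine coindV_eq_zero (klingenProj ψ₀ γ η τ f) hψ₀ hN ?_ ?_ fun h => ?_
    · refine eq_zero_of_mem_twistedKer τ (N11 F) (psiN11 ψ₀ γ) (fun n => ?_) ?_
      · obtain ⟨c, rfl⟩ := exists_unipN n
        have h1 := hN (weylW F) ⟨_, siegelU_mem c 0 0⟩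
        rw [psiC_siegelU, weylW_mul_siegelU, coindV_siegelU_mul] at h1
        exact h1
      · rw [← hlam]; exact hW
    · refine eq_zero_of_mem_twistedKer τ (N11 F) 1 (fun n => ?_) ?_
      · obtain ⟨c, rfl⟩ := exists_unipN n
        have h1 := hN (weylS F) ⟨_, siegelU_mem 0 0 c⟩
        rw [psiC_siegelU, weylS_mul_siegelU, coindV_siegelU_mul] at h1
        rw [mul_zero, AddChar.map_zero_eq_one, one_smul] at h1
        rw [MonoidHom.one_apply, one_smul]
        exact h1
      · exact (Submodule.Quotient.mk_eq_zero _).1 hS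
    -- Translating `f` by `h` reduces every point of the open part to the single representative `s
    -- w`.
    · rw [← klingenProj_rep]
      refine eq_zero_of_mem_twistedKer τ (N11 F) (psiN11 ψ₀ γ) (fun n => ?_) ?_
      · obtain ⟨c, rfl⟩ := exists_unipN n
        have h1 := twistProj_induced_mul (klingenInflation η τ) (siegelN F) (psiC ψ₀ γ)
          (klingenInd η τ (siegelLevi (h : GL (Fin 2) F)) f) (weylS F * weylW F)
          ⟨_, siegelU_mem c 0 0⟩
        rw [psiC_siegelU, mul_assoc, weylW_mul_siegelU, ← mul_assoc, weylS_mul_siegelU, mul_assoc,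
          coindV_siegelU_mul] at h1
        exact h1
      · rw [← hlam, klingenProj_rep]
        exact congrFun (congrArg Subtype.val hO) h
  · intro hf
    have h1 : ∀ g, klingenEval ψ₀ γ η τ g f = 0 := fun g => by
      rw [klingenEval_apply, klingenProj, hf]; rfl
    rw [decompose_apply, h1, h1, map_zero, map_zero]
    have h2 : openComponent ψ₀ γ η lam f = 0 := Subtype.ext (funext fun h => by
      rw [openComponent_apply, h1, map_zero]; rfl)
    rw [h2]
    rfl

/-- All of `N` is conjugated by `w` into `Q`, with `ψ_C` matching `ψ_γ`, which `lam` respects. The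
other two components vanish because the row of `w` has `x = 0`. -/
theorem exists_decompose_weylW
    (hlam : LinearMap.ker lam = twistedKer τ (N11 F) (psiN11 ψ₀ γ)) :
    ∃ k : ℂ, k ≠ 0 ∧ ∀ v : V, decompose ψ₀ γ η lam
      (inducedDelta (klingen F) (klingenInflation η τ) (weylW F) v) = (k • lam v, 0, 0) := by
  obtain ⟨k, hk, h⟩ := exists_twistProj_delta (klingenInflation η τ) (siegelN F) (psiC ψ₀ γ) lam
    (weylW F) fun u q v hq => by
      obtain ⟨a, b, c, rfl⟩ := exists_siegelU u
      rw [weylW_mul_siegelU, mul_inv_cancel_right] at hq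
      have hq' : q = ⟨siegelU c b a, siegelU_mem_klingen c b a⟩ := Subtype.ext hq
      rw [hq', klingenInflation_siegelU, map_unip_of_ker hlam, psiC_siegelU]
  refine ⟨k, hk, fun v => ?_⟩
  rw [decompose_apply]
  refine Prod.ext (h v) (Prod.ext ?_ (Subtype.ext (funext fun g => ?_)))
  · change (twistedKer τ (N11 F) 1).mkQ _ = 0
    rw [klingenEval_delta_eq_zero, map_zero]
    intro a b c t ht
    have := ht (Sum.inl 0)
    rw [(row_mul_siegelU _ a b c).1, row_weylS, row_weylW] at this
    simp at this
  · change (openComponent ψ₀ γ η lam _).1 g = 0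
    rw [openComponent_apply, klingenEval_delta_eq_zero, map_zero]
    intro a b c t ht
    have := ht (Sum.inl 1)
    rw [(row_mul_siegelU _ a b c).1, row_weylS_mul_weylW_mul_siegelLevi, row_weylW] at this
    have h2 := (o2d γ g).ne_zero
    refine h2 (?_ : (g : GL (Fin 2) F).1 1 1 = 0)
    simpa using this

/-- The part of `N` conjugated by `s` into `Q` consists of the `siegelU 0 0 c`, where `ψ_C` is
trivial; hence the untwisted coinvariants appear. -/
theorem exists_decompose_weylS :
    ∃ k : ℂ, k ≠ 0 ∧ ∀ v : V, decompose ψ₀ γ η lam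
      (inducedDelta (klingen F) (klingenInflation η τ) (weylS F) v) =
        (0, k • (twistedKer τ (N11 F) 1).mkQ v, 0) := by
  obtain ⟨k, hk, h⟩ := exists_twistProj_delta (klingenInflation η τ) (siegelN F) (psiC ψ₀ γ)
    (twistedKer τ (N11 F) 1).mkQ (weylS F) fun u q v hq => by
      obtain ⟨a, b, c, rfl⟩ := exists_siegelU u
      obtain ⟨t, ht⟩ := mul_inv_mem_klingen_iff.1 (hq ▸ q.2)
      have h0 := ht (Sum.inr 0)
      have h1 := ht (Sum.inr 1)
      rw [(row_mul_siegelU _ a b c).2.1, row_weylS] at h0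
      rw [(row_mul_siegelU _ a b c).2.2, row_weylS] at h1
      simp at h0 h1
      subst h0 h1
      rw [weylS_mul_siegelU, mul_inv_cancel_right] at hq
      have hq' : q = ⟨siegelU 0 0 c, siegelU_mem_klingen 0 0 c⟩ := Subtype.ext hq
      rw [hq', klingenInflation_siegelU, mkQ_unip, psiC_siegelU]
      simp
  refine ⟨k, hk, fun v => ?_⟩
  rw [decompose_apply]
  refine Prod.ext ?_ (Prod.ext (h v) (Subtype.ext (funext fun g => ?_)))
  · change lam _ = 0
    rw [klingenEval_delta_eq_zero, map_zero]
    intro a b c t ht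
    have := ht (Sum.inl 0)
    rw [(row_mul_siegelU _ a b c).1, row_weylS, row_weylW] at this
    simp at this
  · change (openComponent ψ₀ γ η lam _).1 g = 0
    rw [openComponent_apply, klingenEval_delta_eq_zero, map_zero]
    intro a b c t ht
    have := ht (Sum.inl 1)
    rw [(row_mul_siegelU _ a b c).1, row_weylS_mul_weylW_mul_siegelLevi, row_weylS] at this
    have h2 := (o2d γ g).ne_zero
    refine h2 (?_ : (g : GL (Fin 2) F).1 1 1 = 0)
    simpa using this

/-- The part of `N` conjugated by `s w` into `Q` consists of the `siegelU a 0 0`, where `ψ_C`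
becomes `ψ_γ`. On the open part the image is supported on `T₂`, since the row of `s w g` is
proportional to that of `s w` only if `g` has lower left entry `0`. -/
theorem exists_decompose_weylS_mul_weylW
    (hlam : LinearMap.ker lam = twistedKer τ (N11 F) (psiN11 ψ₀ γ)) :
    ∃ k : ℂ, k ≠ 0 ∧ ∀ v : V, decompose ψ₀ γ η lam
      (inducedDelta (klingen F) (klingenInflation η τ) (weylS F * weylW F) v) =
        (0, 0, k • inducedDelta (T2 γ) _ 1 (lam v)) := by
  obtain ⟨k, hk, h⟩ := exists_twistProj_delta (klingenInflation η τ) (siegelN F) (psiC ψ₀ γ)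
    lam (weylS F * weylW F) fun u q v hq => by
      obtain ⟨a, b, c, rfl⟩ := exists_siegelU u
      obtain ⟨t, ht⟩ := mul_inv_mem_klingen_iff.1 (hq ▸ q.2)
      have h0 := ht (Sum.inr 0)
      have h1 := ht (Sum.inr 1)
      rw [(row_mul_siegelU _ a b c).2.1, row_weylS_mul_weylW] at h0
      rw [(row_mul_siegelU _ a b c).2.2, row_weylS_mul_weylW] at h1
      simp at h0 h1
      subst h0 h1
      rw [mul_assoc (weylS F), weylW_mul_siegelU, ← mul_assoc, weylS_mul_siegelU, mul_assoc,
        mul_assoc, ← mul_assoc (weylS F), mul_inv_cancel, mul_one] at hq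
      have hq' : q = ⟨siegelU 0 0 a, siegelU_mem_klingen 0 0 a⟩ := Subtype.ext hq
      rw [hq', klingenInflation_siegelU, map_unip_of_ker hlam, psiC_siegelU]
  refine ⟨k, hk, fun v => ?_⟩
  rw [decompose_apply]
  refine Prod.ext ?_ (Prod.ext ?_ (Subtype.ext (funext fun g => ?_)))
  · change lam _ = 0
    rw [klingenEval_delta_eq_zero, map_zero]
    intro a b c t ht
    have := ht (Sum.inl 1)
    rw [(row_mul_siegelU _ a b c).1, row_weylS_mul_weylW, row_weylW] at this
    simp at this
  · change (twistedKer τ (N11 F) 1).mkQ _ = 0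
    rw [klingenEval_delta_eq_zero, map_zero]
    intro a b c t ht
    have := ht (Sum.inl 0)
    rw [(row_mul_siegelU _ a b c).1, row_weylS_mul_weylW, row_weylS] at this
    simp at this
  · change (openComponent ψ₀ γ η lam _).1 g = k • (inducedDelta (T2 γ) _ 1 (lam v)).1 g
    -- On `T₂` both sides are determined by equivariance from their values at `1`.
    by_cases hg : g ∈ T2 γ
    · have h1 := coindV_mul (openComponent ψ₀ γ η lam
        (inducedDelta (klingen F) (klingenInflation η τ) (weylS F * weylW F) v)) ⟨g, hg⟩ 1
      have h2 := coindV_mul (inducedDelta (T2 γ)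
        (scalarRep W (t2Char γ (centralCharacter τ) η⁻¹)) 1 (lam v)) ⟨g, hg⟩ 1
      rw [mul_one] at h1 h2
      rw [h1, h2, ← map_smul]
      congr 1
      rw [inducedDelta_of_mem _ _ (by simp : (1 : O2 γ) * 1⁻¹ ∈ T2 γ), openComponent_apply]
      have h3 : (⟨(1 : O2 γ) * 1⁻¹, by simp⟩ : T2 γ) = 1 := Subtype.ext (by simp)
      rw [h3, map_one, Module.End.one_apply, ← h v]
      simp [klingenEval_apply]
    · rw [inducedDelta_of_notMem _ _ (by simpa using hg), smul_zero, openComponent_apply,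
        klingenEval_delta_eq_zero, map_zero]
      intro a b c t ht
      have := ht (Sum.inl 0)
      rw [(row_mul_siegelU _ a b c).1, row_weylS_mul_weylW_mul_siegelLevi, row_weylS_mul_weylW]
        at this
      refine hg (?_ : (g : GL (Fin 2) F).1 1 0 = 0)
      simpa using this

theorem inl_mem_range_decompose (hsurj : Function.Surjective lam)
    (hlam : LinearMap.ker lam = twistedKer τ (N11 F) (psiN11 ψ₀ γ)) (w : W) :
    (w, 0, 0) ∈ LinearMap.range (decompose (τ := τ) ψ₀ γ η lam) := by
  obtain ⟨k, hk, h⟩ := exists_decompose_weylW (η := η) hlam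
  obtain ⟨v, rfl⟩ := hsurj w
  refine ⟨inducedDelta _ _ (weylW F) (k⁻¹ • v), ?_⟩
  rw [h, map_smul, smul_smul, mul_inv_cancel₀ hk, one_smul]

theorem inr_inl_mem_range_decompose (z : JacquetSpace τ (N11 F) 1) :
    (0, z, 0) ∈ LinearMap.range (decompose (τ := τ) ψ₀ γ η lam) := by
  obtain ⟨k, hk, h⟩ := exists_decompose_weylS (ψ₀ := ψ₀) (γ := γ) (η := η) (τ := τ) (lam := lam)
  obtain ⟨v, rfl⟩ := Submodule.mkQ_surjective _ z
  refine ⟨inducedDelta _ _ (weylS F) (k⁻¹ • v), ?_⟩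
  rw [h, map_smul, smul_smul, mul_inv_cancel₀ hk, one_smul]

theorem inr_inr_delta_mem_range_decompose (hsurj : Function.Surjective lam)
    (hlam : LinearMap.ker lam = twistedKer τ (N11 F) (psiN11 ψ₀ γ)) (g : O2 γ) (w : W) :
    (0, 0, scalarInd W γ η τ g (inducedDelta (T2 γ) _ 1 w)) ∈
      LinearMap.range (decompose (τ := τ) ψ₀ γ η lam) := by
  obtain ⟨k, hk, h⟩ := exists_decompose_weylS_mul_weylW (η := η) hlam
  obtain ⟨v, rfl⟩ := hsurj w
  have h1 := decompose_rep (ψ₀ := ψ₀) (lam := lam) g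
    (inducedDelta _ (klingenInflation η τ) (weylS F * weylW F) v)
  rw [h] at h1
  rw [← Submodule.smul_mem_iff _ hk]
  refine ⟨_, h1.trans (Prod.ext ?_ (Prod.ext ?_ ?_))⟩
  · exact (map_zero (scalarO2 W γ η τ g)).trans (smul_zero k).symm
  · exact (map_zero (rho1 γ η τ g)).trans (smul_zero k).symm
  · exact map_smul (scalarInd W γ η τ g) k _

/-- The range is stable under `O₂`, and the translates of functions supported on `T₂` span the
induced representation. -/
theorem inr_inr_mem_range_decompose (hsurj : Function.Surjective lam)
    (hlam : LinearMap.ker lam = twistedKer τ (N11 F) (psiN11 ψ₀ γ))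
    (φ : Representation.coindV (T2 γ).subtype
      (scalarRep W (t2Char γ (centralCharacter τ) η⁻¹))) :
    (0, 0, φ) ∈ LinearMap.range (decompose (τ := τ) ψ₀ γ η lam) := by
  have := Fintype.ofFinite (O2 γ)
  let K := (LinearMap.range (decompose (τ := τ) ψ₀ γ η lam)).comap
    (LinearMap.inr ℂ W _ ∘ₗ LinearMap.inr ℂ (JacquetSpace τ (N11 F) 1) _)
  have hc : (Nat.card (T2 γ) : ℂ) ≠ 0 := by exact_mod_cast Nat.card_pos.ne'
  suffices h : φ ∈ K from h
  rw [← Submodule.smul_mem_iff K hc, induced_eq_sum_delta]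
  exact Submodule.sum_mem K fun g _ => inr_inr_delta_mem_range_decompose hsurj hlam _ _

theorem decompose_surjective (hsurj : Function.Surjective lam)
    (hlam : LinearMap.ker lam = twistedKer τ (N11 F) (psiN11 ψ₀ γ)) :
    Function.Surjective (decompose (τ := τ) ψ₀ γ η lam) := by
  rw [← LinearMap.range_eq_top, eq_top_iff]
  rintro ⟨w, z, φ⟩ -
  have h := Submodule.add_mem _ (inl_mem_range_decompose (η := η) hsurj hlam w)
    (Submodule.add_mem _ (inr_inl_mem_range_decompose z)
      (inr_inr_mem_range_decompose hsurj hlam φ))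
  simpa only [Prod.mk_add_mk, add_zero, zero_add] using h

/-- The decomposition of the twisted Jacquet module of a Klingen induced representation, with
`W` the space of `ψ_γ`-coinvariants of `τ`. -/
theorem nonempty_jacquetC_equiv (hψ₀ : ψ₀ ≠ 1) (hsurj : Function.Surjective lam)
    (hlam : LinearMap.ker lam = twistedKer τ (N11 F) (psiN11 ψ₀ γ)) :
    Nonempty ((jacquetC ψ₀ γ (klingenInd η τ)).Equiv
      ((scalarO2 W γ η τ).prod ((rho1 γ η τ).prod (scalarInd W γ η τ)))) := by
  have hker := ker_decompose (η := η) hψ₀ hlam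
  let e : JacquetSpace (klingenInd η τ) (siegelN F) (psiC ψ₀ γ) ≃ₗ[ℂ] _ :=
    (Submodule.quotEquivOfEq _ _ hker.symm).trans
      ((decompose (τ := τ) ψ₀ γ η lam).quotKerEquivOfSurjective (decompose_surjective hsurj hlam))
  refine ⟨Representation.Equiv.mk e fun h => LinearMap.ext fun x => ?_⟩
  obtain ⟨f, rfl⟩ := Submodule.mkQ_surjective _ x
  exact decompose_rep h f

end Decomposition

/-! ### Specialization to zero and one-dimensional Whittaker spaces -/

section Cases

variable {F : Type*} [Field F] [Finite F] {V : Type*} [AddCommGroup V] [Module ℂ V]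
  {ψ₀ : AddChar F ℂ} {γ : Fˣ} {η : Fˣ →* ℂˣ} {τ : Representation ℂ (SL2 F) V} [τ.IsIrreducible]

theorem nonempty_jacquetC_equiv_rho1 (hψ₀ : ψ₀ ≠ 1)
    (h : Subsingleton (JacquetSpace τ (N11 F) (psiN11 ψ₀ γ))) :
    Nonempty ((jacquetC ψ₀ γ (klingenInd η τ)).Equiv (rho1 γ η τ)) := by
  obtain ⟨e⟩ := nonempty_jacquetC_equiv (η := η) hψ₀ (Submodule.mkQ_surjective _)
    (Submodule.ker_mkQ (twistedKer τ (N11 F) (psiN11 ψ₀ γ)))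
  obtain ⟨e₁⟩ := nonempty_prod_equiv_right
    (scalarO2 (JacquetSpace τ (N11 F) (psiN11 ψ₀ γ)) γ η τ)
    ((rho1 γ η τ).prod (scalarInd (JacquetSpace τ (N11 F) (psiN11 ψ₀ γ)) γ η τ))
  obtain ⟨e₂⟩ := nonempty_prod_equiv_left (rho1 γ η τ)
    (scalarInd (JacquetSpace τ (N11 F) (psiN11 ψ₀ γ)) γ η τ)
  exact ⟨e.trans (e₁.trans e₂)⟩

/-- Here the Whittaker space is exactly one-dimensional. Composing the quotient map with an
isomorphism onto `ℂ` makes the general decomposition coincide with `mu1`; this is why that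
decomposition allows an arbitrary surjection `lam` with the right kernel. -/
theorem nonempty_jacquetC_equiv_mu1 (hψ₀ : ψ₀ ≠ 1)
    (h : Nontrivial (JacquetSpace τ (N11 F) (psiN11 ψ₀ γ))) :
    Nonempty ((jacquetC ψ₀ γ (klingenInd η τ)).Equiv (mu1 γ η τ)) := by
  have := finiteDimensional_of_isIrreducible τ
  have h1 : Module.finrank ℂ (JacquetSpace τ (N11 F) (psiN11 ψ₀ γ)) = Module.finrank ℂ ℂ := by
    rw [Module.finrank_self]
    exact le_antisymm (finrank_jacquetSpace_le_one τ (psiN11_ne_one hψ₀ γ.ne_zero))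
      Module.finrank_pos
  let e := LinearEquiv.ofFinrankEq _ _ h1
  refine nonempty_jacquetC_equiv hψ₀
    (lam := e.toLinearMap ∘ₗ (twistedKer τ (N11 F) (psiN11 ψ₀ γ)).mkQ) ?_ ?_
  · exact e.surjective.comp (Submodule.mkQ_surjective _)
  · rw [LinearEquiv.ker_comp, Submodule.ker_mkQ]

theorem nonempty_jacquetC_equiv_mu2 (hψ₀ : ψ₀ ≠ 1) (hτ : IsCuspidal τ)
    (h : Nontrivial (JacquetSpace τ (N11 F) (psiN11 ψ₀ γ))) :
    Nonempty ((jacquetC ψ₀ γ (klingenInd η τ)).Equiv (mu2 γ η τ)) := by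
  have : Subsingleton (JacquetSpace τ (N11 F) 1) := hτ
  obtain ⟨e⟩ := nonempty_jacquetC_equiv_mu1 (η := η) hψ₀ h
  refine ⟨e.trans (Representation.IntertwiningMap.ofBijective
    (((Representation.IntertwiningMap.fst ℂ _ _)).prod
      ((Representation.IntertwiningMap.snd ℂ _ _).comp (Representation.IntertwiningMap.snd ℂ _ _)))
    ⟨fun x y hxy => ?_, fun x => ⟨(x.1, 0, x.2), rfl⟩⟩)⟩
  have h1 := congrArg Prod.fst hxy
  have h2 := congrArg Prod.snd hxy
  exact Prod.ext h1 (Prod.ext (Subsingleton.elim _ _) h2)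

end Cases

end KlingenJacquet

end

theorem mainTheorem5 {F : Type*} [Field F] [Fintype F] (hF : ringChar F ≠ 2)
    (ψ₀ : AddChar F ℂ) (hψ₀ : ψ₀ ≠ 1) (γ : Fˣ) (η : Fˣ →* ℂˣ)
    {V : Type*} [AddCommGroup V] [Module ℂ V]
    (τ : Representation ℂ (KlingenJacquet.SL2 F) V) (hτ : τ.IsIrreducible)
    (Ψ Ψ' : KlingenJacquet.N11 F →* ℂ) (hΨ : Ψ ≠ 1) (hΨ' : Ψ' ≠ 1)
    (hΨΨ' : ¬ KlingenJacquet.InTorusOrbit Ψ Ψ') :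
    -- (1) `τ` one-dimensional (for `q = 3`: the trivial representation)
    (Module.finrank ℂ V = 1 → (Fintype.card F = 3 → τ.IsTrivial) →
      Nonempty ((KlingenJacquet.jacquetC ψ₀ γ (KlingenJacquet.klingenInd η τ)).Equiv
        (KlingenJacquet.rho1 γ η τ))) ∧
    -- (2) `τ` an irreducible principal series representation or the special representation
    (KlingenJacquet.IsPrincipalSeries τ ∨ KlingenJacquet.IsSteinberg τ →
      Nonempty ((KlingenJacquet.jacquetC ψ₀ γ (KlingenJacquet.klingenInd η τ)).Equiv
        (KlingenJacquet.mu1 γ η τ))) ∧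
    -- (3) `τ` cuspidal of dimension `q - 1`
    (KlingenJacquet.IsCuspidal τ → Module.finrank ℂ V + 1 = Fintype.card F →
      Nonempty ((KlingenJacquet.jacquetC ψ₀ γ (KlingenJacquet.klingenInd η τ)).Equiv
        (KlingenJacquet.mu2 γ η τ))) ∧
    -- (4) `τ = τ₁`, the component of `Ind_B^{SL₂}(χ)`, `χ` of order two, that sees `Ψ`, not `Ψ'`
    (∀ χ : Fˣ →* ℂˣ, orderOf χ = 2 →
      KlingenJacquet.IsConstituent τ (KlingenJacquet.principalSeries χ) →
      Nontrivial (KlingenJacquet.JacquetSpace τ (KlingenJacquet.N11 F) Ψ) →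
      Subsingleton (KlingenJacquet.JacquetSpace τ (KlingenJacquet.N11 F) Ψ') →
      (KlingenJacquet.InTorusOrbit Ψ (KlingenJacquet.psiN11 ψ₀ γ) →
        Nonempty ((KlingenJacquet.jacquetC ψ₀ γ (KlingenJacquet.klingenInd η τ)).Equiv
          (KlingenJacquet.mu1 γ η τ))) ∧
      (¬ KlingenJacquet.InTorusOrbit Ψ (KlingenJacquet.psiN11 ψ₀ γ) →
        Nonempty ((KlingenJacquet.jacquetC ψ₀ γ (KlingenJacquet.klingenInd η τ)).Equiv
          (KlingenJacquet.rho1 γ η τ)))) ∧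
    -- (5) `τ = τ₁'`, the cuspidal representation of dimension `(q - 1) / 2` that sees `Ψ`, not `Ψ'`
    (KlingenJacquet.IsCuspidal τ → 2 * Module.finrank ℂ V + 1 = Fintype.card F →
      Nontrivial (KlingenJacquet.JacquetSpace τ (KlingenJacquet.N11 F) Ψ) →
      Subsingleton (KlingenJacquet.JacquetSpace τ (KlingenJacquet.N11 F) Ψ') →
      (KlingenJacquet.InTorusOrbit Ψ (KlingenJacquet.psiN11 ψ₀ γ) →
        Nonempty ((KlingenJacquet.jacquetC ψ₀ γ (KlingenJacquet.klingenInd η τ)).Equiv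
          (KlingenJacquet.mu2 γ η τ))) ∧
      (¬ KlingenJacquet.InTorusOrbit Ψ (KlingenJacquet.psiN11 ψ₀ γ) →
        Subsingleton (KlingenJacquet.JacquetSpace (KlingenJacquet.klingenInd η τ)
          (KlingenJacquet.siegelN F) (KlingenJacquet.psiC ψ₀ γ)))) := by
  have hθ : KlingenJacquet.psiN11 ψ₀ (γ : F) ≠ 1 := KlingenJacquet.psiN11_ne_one hψ₀ γ.ne_zero
  -- There are only two orbits of non-trivial characters, so outside the orbit of `Ψ` the character
  -- `ψ_γ` inherits vanishing from `Ψ'`.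
  have hsub : ¬ KlingenJacquet.InTorusOrbit Ψ (KlingenJacquet.psiN11 ψ₀ γ) →
      Subsingleton (KlingenJacquet.JacquetSpace τ (KlingenJacquet.N11 F) Ψ') →
      Subsingleton (KlingenJacquet.JacquetSpace τ (KlingenJacquet.N11 F)
        (KlingenJacquet.psiN11 ψ₀ γ)) := fun hno h =>
    KlingenJacquet.subsingleton_jacquetSpace_of_inTorusOrbit τ
      ((KlingenJacquet.inTorusOrbit_or_inTorusOrbit hψ₀ hΨ hΨ' hθ hΨΨ').resolve_left hno) h
  refine ⟨fun hdim htriv => ?_, fun h => ?_, fun hc hdim => ?_, fun χ _ _ hnt hss => ⟨fun h => ?_,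
    fun h => ?_⟩, fun hc _ hnt hss => ⟨fun h => ?_, fun h => ?_⟩⟩
  · refine KlingenJacquet.nonempty_jacquetC_equiv_rho1 hψ₀
      (KlingenJacquet.subsingleton_jacquetSpace_of_trivial_unip τ hθ fun n v => ?_)
    by_cases hcard : Fintype.card F = 3
    · have := htriv hcard
      exact τ.isTrivial_apply _ _
    · exact KlingenJacquet.unip_trivial_of_finrank_eq_one τ hF hdim hcard n v
  · refine KlingenJacquet.nonempty_jacquetC_equiv_mu1 hψ₀ ?_
    rcases h with h | h
    · exact KlingenJacquet.nontrivial_jacquetSpace_of_isPrincipalSeries h ψ₀ γ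
    · exact KlingenJacquet.nontrivial_jacquetSpace_of_isSteinberg h hψ₀ γ.ne_zero
  · exact KlingenJacquet.nonempty_jacquetC_equiv_mu2 hψ₀ hc
      (KlingenJacquet.nontrivial_jacquetSpace_of_isCuspidal τ hc hdim hψ₀ γ.ne_zero)
  · exact KlingenJacquet.nonempty_jacquetC_equiv_mu1 hψ₀
      (KlingenJacquet.nontrivial_jacquetSpace_of_inTorusOrbit τ h hnt)
  · exact KlingenJacquet.nonempty_jacquetC_equiv_rho1 hψ₀ (hsub h hss)
  · exact KlingenJacquet.nonempty_jacquetC_equiv_mu2 hψ₀ hc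
      (KlingenJacquet.nontrivial_jacquetSpace_of_inTorusOrbit τ h hnt)
  -- The Jacquet module is `ϱ₁`, whose space `r_{N₁₁}(τ)` is zero by cuspidality.
  · obtain ⟨e⟩ := KlingenJacquet.nonempty_jacquetC_equiv_rho1 (η := η) hψ₀ (hsub h hss)
    have : Subsingleton (KlingenJacquet.JacquetSpace τ (KlingenJacquet.N11 F) 1) := hc
    exact e.toLinearEquiv.toEquiv.subsingleton
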